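/- **Setting.** Let $\Omega\subseteq\mathbb R^n$ be open and convex and let $\Psi:\Omega\to\mathbb R$ be $C^4$ and strongly convex, i.e. for some $m>0$ the function $\Psi-\tfrac m2|\cdot|^2$ is convex on $\Omega$. Write $\Psi_{ij},\Psi_{ijk},\Psi_{ijkl}$ for its partial derivatives, $(\Psi^{pq})$ for the inverse of $(\Psi_{ij})$, and for $u,v\in\mathbb R^n$ $$\mathfrak A(u,v)=\sum_{i,j,k,l}\Big(-\Psi_{ijkl}+\sum_{p,q}\Psi_{ijp}\Psi_{klq}\Psi^{pq}\Big)u_iu_jv_kv_l .$$ The Kähler Sasaki metric on the tube domain $T\Omega=\Omega\times\mathbb R^n\subseteq\mathbb C^n$, with Kähler form $\sqrt{-1}\sum\Psi_{ij}(x)\,dz_i\wedge d\bar z_j$, has **(NOAB)** if at every point $\mathfrak A(u,v)\ge 0$ for all $u,v\in\mathbb R^n$ with $\sum_{i,j}\Psi_{ij}u_iv_j=0$. A cost $c:X\times Y\to\mathbb R$ ($X,Y\subseteq\mathbb R^n$ open) satisfies **(QQConv)** on $(X,Y)$ if there is $M\ge1$ such that the following holds. For all $x_0\in X$, $y_0,y_1\in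 Y$ there is a $c^*$-segment $t\mapsto y(t)\in Y$, $t\in[0,1]$, with respect to $x_0$ from $y_0$ to $y_1$, i.e. $y(0)=y_0$, $y(1)=y_1$ and $D_xc(x_0,y(t))=(1-t)D_xc(x_0,y_0)+tD_xc(x_0,y_1)$, such that for all $x\in X$, $t\in[0,1]$ $$-c(x,y(t))+c(x,y_0)-\big(-c(x_0,y(t))+c(x_0,y_0)\big)\le Mt\,\big[-c(x,y_1)+c(x,y_0)-(-c(x_0,y_1)+c(x_0,y_0))\big]_+ ;$$ and for all $y_0\in Y$, $x_0,x_1\in X$ there is a $c$-segment $s\mapsto x(s)\in X$, $s\in[0,1]$, with respect to $y_0$ from $x_0$ to $x_1$, i.e. $x(0)=x_0$, $x(1)=x_1$ and $D_yc(x(s),y_0)=(1-s)D_yc(x_0,y_0)+sD_yc(x_1,y_0)$, such that for all $y\in Y$, $s\in[0,1]$ $$-c(x(s),y)+c(x_0,y)-\big(-c(x(s),y_0)+c(x_0,y_0)\big)\le Ms\,\big[-c(x_1,y)+c(x_0,y)-(-c(x_1,y_0)+c(x_0,y_0))\big]_+ .$$ Here $[a]_+=\max(a,0)$. For $U\subseteq\Omega$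 say that *$\Psi$ satisfies (QQConv) on small balls in $U$* if there is $\varepsilon_0>0$ such that for every $0<\varepsilon\le\varepsilon_0$ and all $x_1,x_2\in\mathbb R^n$ with $B(x_1,\varepsilon)-B(x_2,\varepsilon)\subseteq U$, the $\Psi$-cost $c(x,y)=\Psi(x-y)$ satisfies (QQConv) on the pair of open Euclidean balls $X=B(x_1,\varepsilon)$, $Y=B(x_2,\varepsilon)$. **Theorem.** 1. If the derivatives of $\Psi$ of orders $2,3,4$ are bounded on $\Omega$, then the Kähler Sasaki metric on $T\Omega$ has (NOAB) if and only if $\Psi$ satisfies (QQConv) on small balls in $\Omega$. 2. Without any bound on the derivatives, the Kähler Sasaki metric on $T\Omega$ has (NOAB) if and only if for every compact $K\subseteq\Omega$, $\Psi$ satisfies (QQConv) on small balls in $K$ (with $\varepsilon_0$ depending on $K$). -/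

import Mathlib

/-! ### Anti-bisectional curvature of the Kähler Sasaki metric with potential `Ψ` -/

section Curvature

/-- The Hessian matrix `Ψ_{ij}(x)`; these are the components of the Hessian metric on `Ω` and, in the
coordinates `z = x + √-1 y`, of the Kähler Sasaki metric on the tube domain `TΩ`, which do not
depend on `y`. -/
noncomputable def hessianMatrix {n : ℕ} (Ψ : EuclideanSpace ℝ (Fin n) → ℝ)
    (x : EuclideanSpace ℝ (Fin n)) : Matrix (Fin n) (Fin n) ℝ :=
  Matrix.of fun i j =>
    iteratedFDeriv ℝ 2 Ψ x ![EuclideanSpace.single i 1, EuclideanSpace.single j 1]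

/-- The anti-bisectional curvature
`𝔄(u,v) = ∑_{ijkl} (-Ψ_{ijkl} + ∑_{pq} Ψ_{ijp} Ψ_{klq} Ψ^{pq}) u_i u_j v_k v_l
        = -Ψ_{uuvv} + ∑_{pq} Ψ_{uup} Ψ_{vvq} Ψ^{pq}`
at a point of `TΩ` over `x`, where `Ψ^{pq}` is the inverse of the Hessian matrix. -/
noncomputable def antiBisectional {n : ℕ} (Ψ : EuclideanSpace ℝ (Fin n) → ℝ)
    (x u v : EuclideanSpace ℝ (Fin n)) : ℝ :=
  -iteratedFDeriv ℝ 4 Ψ x ![u, u, v, v]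
    + ∑ p : Fin n, ∑ q : Fin n,
        iteratedFDeriv ℝ 3 Ψ x ![u, u, EuclideanSpace.single p 1]
          * iteratedFDeriv ℝ 3 Ψ x ![v, v, EuclideanSpace.single q 1]
          * (hessianMatrix Ψ x)⁻¹ p q

/-- (NOAB): the Kähler Sasaki metric with potential `Ψ` on `TΩ` satisfies `𝔄(u,v) ≥ 0` at every
point, for all real vectors `u`, `v` with `Ψ_{uv} = 0`. -/
def NOAB {n : ℕ} (Ω : Set (EuclideanSpace ℝ (Fin n))) (Ψ : EuclideanSpace ℝ (Fin n) → ℝ) : Prop :=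
  ∀ x ∈ Ω, ∀ u v : EuclideanSpace ℝ (Fin n),
    iteratedFDeriv ℝ 2 Ψ x ![u, v] = 0 → 0 ≤ antiBisectional Ψ x u v

end Curvature

/-! ### Cost functions, `c`-segments and quantitative quasiconvexity -/

section Transport

/-- The `Ψ`-cost `c(x,y) = Ψ(x - y)`. -/
def psiCost {E : Type*} [AddGroup E] (Ψ : E → ℝ) (x y : E) : ℝ := Ψ (x - y)

/-- `γ` is the `c*`-segment in `Y` with respect to `x₀` from `y₀` to `y₁`:
`D_x c(x₀, γ(t))` runs along the line segment from `D_x c(x₀, y₀)` to `D_x c(x₀, y₁)`. -/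
def IsCStarSegment {E : Type*} [NormedAddCommGroup E] [NormedSpace ℝ E]
    (c : E → E → ℝ) (Y : Set E) (x₀ y₀ y₁ : E) (γ : ℝ → E) : Prop :=
  γ 0 = y₀ ∧ γ 1 = y₁ ∧ ∀ t ∈ Set.Icc (0 : ℝ) 1, γ t ∈ Y ∧
    fderiv ℝ (fun x => c x (γ t)) x₀
      = (1 - t) • fderiv ℝ (fun x => c x y₀) x₀ + t • fderiv ℝ (fun x => c x y₁) x₀

/-- `γ` is the `c`-segment in `X` with respect to `y₀` from `x₀` to `x₁`:
`D_y c(γ(s), y₀)` runs along the line segment from `D_y c(x₀, y₀)` to `D_y c(x₁, y₀)`. -/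
def IsCSegment {E : Type*} [NormedAddCommGroup E] [NormedSpace ℝ E]
    (c : E → E → ℝ) (X : Set E) (y₀ x₀ x₁ : E) (γ : ℝ → E) : Prop :=
  γ 0 = x₀ ∧ γ 1 = x₁ ∧ ∀ s ∈ Set.Icc (0 : ℝ) 1, γ s ∈ X ∧
    fderiv ℝ (fun y => c (γ s) y) y₀
      = (1 - s) • fderiv ℝ (fun y => c x₀ y) y₀ + s • fderiv ℝ (fun y => c x₁ y) y₀

/-- (QQConv) for the cost `c` on `X × Y`. The two segments are required to exist; the right-hand
sides carry the positive part `[·]₊ = max · 0`, as without it the condition would force `M = 1`. -/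
def QQConv {E : Type*} [NormedAddCommGroup E] [NormedSpace ℝ E]
    (c : E → E → ℝ) (X Y : Set E) : Prop :=
  ∃ M : ℝ, 1 ≤ M ∧
    (∀ x₀ ∈ X, ∀ y₀ ∈ Y, ∀ y₁ ∈ Y, ∃ γ : ℝ → E, IsCStarSegment c Y x₀ y₀ y₁ γ ∧
      ∀ x ∈ X, ∀ t ∈ Set.Icc (0 : ℝ) 1,
        -c x (γ t) + c x y₀ - (-c x₀ (γ t) + c x₀ y₀)
          ≤ M * t * max (-c x y₁ + c x y₀ - (-c x₀ y₁ + c x₀ y₀)) 0) ∧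
    (∀ y₀ ∈ Y, ∀ x₀ ∈ X, ∀ x₁ ∈ X, ∃ γ : ℝ → E, IsCSegment c X y₀ x₀ x₁ γ ∧
      ∀ y ∈ Y, ∀ s ∈ Set.Icc (0 : ℝ) 1,
        -c (γ s) y + c x₀ y - (-c (γ s) y₀ + c x₀ y₀)
          ≤ M * s * max (-c x₁ y + c x₀ y - (-c x₁ y₀ + c x₀ y₀)) 0)

/-- The `Ψ`-cost satisfies (QQConv) on every pair of sufficiently small Euclidean balls
`X = B(x₁,ε)`, `Y = B(x₂,ε)` of equal radius with `X - Y ⊆ U`; how small does not depend on the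
centres. -/
def QQConvOnSmallBalls {n : ℕ} (U : Set (EuclideanSpace ℝ (Fin n)))
    (Ψ : EuclideanSpace ℝ (Fin n) → ℝ) : Prop :=
  ∃ ε₀ : ℝ, 0 < ε₀ ∧ ∀ ε : ℝ, 0 < ε → ε ≤ ε₀ → ∀ x₁ x₂ : EuclideanSpace ℝ (Fin n),
    (∀ x ∈ Metric.ball x₁ ε, ∀ y ∈ Metric.ball x₂ ε, x - y ∈ U) →
      QQConv (psiCost Ψ) (Metric.ball x₁ ε) (Metric.ball x₂ ε)

end Transport

/-! In the variable `w = x - y`, both kinds of segments for `Ψ(x - y)` are curves along which `𝐃 Ψ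
(w t)` is affine, and both halves of (QQConv) concern `F t = -Ψ (w t + h) + Ψ (w t)`. With `u = w'`
and `a = w''`, one has `Ψ_{uu·} + Ψ_{a·} = 0` at `w`, `F' = -(𝐃 Ψ (w + h) - 𝐃 Ψ w) u`, and `F''` is
the difference between `w + h` and `w` of `g = -Ψ_{uu} - Ψ_a`, with `u` and `a` frozen.

Join `w` to `w + h` by a second such curve `z`. Along it `g` has initial slope zero and second
derivative `𝔄(u, z')`, while `Ψ_{uz'}` stays equal to `-F'`.

Sufficiency: projecting `v` off `u` turns (NOAB) into `𝔄(u,v) ≥ -C |Ψ_{uv}| |u| |v|`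
(`antiBisectional_ge`). Hence `F'' ≥ -C |F'|` (`second_variation_ge`), and a Gronwall argument gives
(QQConv) with `M = exp (C + 1)` (`sub_le_exp_mul_max_of_deriv2_ge`). The curves stay in the balls
because gradient images of small balls are convex (`StrongConvexOn.convex_image_fderiv_ball`).

Necessity: if `𝔄(u,v) < 0` and `Ψ_{uv} = 0`, the same two variations produce an `F` with a strict
local maximum at the middle of a segment. Oriented so that `F` does not increase from start to end,
the segment has zero right-hand side in (QQConv), whatever `M` is. -/

open Set Filter Topology

set_option maxSynthPendingDepth 3

local notation "𝐃" => fderiv ℝ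

/-! ### First and second order consequences of strong convexity. -/

section StrongConvexity

variable {E : Type*} [NormedAddCommGroup E] [NormedSpace ℝ E] {f : E → ℝ} {s : Set E} {m : ℝ}
  {x y : E}

theorem HasDerivAt.nonneg_of_eventually_le {g : ℝ → ℝ} {g' : ℝ} (hg : HasDerivAt g g' 0)
    (h : ∀ᶠ t in 𝓝[>] (0 : ℝ), g 0 ≤ g t) : 0 ≤ g' := by
  have h1 := hg.tendsto_slope_zero_right
  refine ge_of_tendsto h1 ?_
  filter_upwards [h, self_mem_nhdsWithin] with t ht ht0
  have ht0' : (0 : ℝ) < t := ht0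
  rw [zero_add, smul_eq_mul]
  have : 0 ≤ g t - g 0 := by linarith
  positivity

theorem HasFDerivAt.hasDerivAt_comp_line {F : Type*} [NormedAddCommGroup F] [NormedSpace ℝ F]
    {g : E → F} {g' : E →L[ℝ] F} (hg : HasFDerivAt g g' x) (v : E) :
    HasDerivAt (fun t : ℝ => g (x + t • v)) (g' v) 0 := by
  have hl : HasDerivAt (fun t : ℝ => x + t • v) v 0 := by
    simpa using ((hasDerivAt_id (0 : ℝ)).smul_const v).const_add x
  have hg' : HasFDerivAt g g' (x + (0 : ℝ) • v) := by simpa using hg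
  exact hg'.comp_hasDerivAt (0 : ℝ) hl

/-- The gap in the strong convexity inequality along the segment vanishes at `t = 0` and is
nonnegative for small `t > 0`, so its derivative there is nonnegative. -/
theorem StrongConvexOn.add_fderiv_add_le (hf : StrongConvexOn s m f) (hx : x ∈ s) (hy : y ∈ s)
    (hd : DifferentiableAt ℝ f x) : f x + 𝐃 f x (y - x) + m / 2 * ‖y - x‖ ^ 2 ≤ f y := by
  have h1 := hd.hasFDerivAt.hasDerivAt_comp_line (y - x)
  have h2 : HasDerivAt (fun t : ℝ => t * (f y - f x) - t * (1 - t) * (m / 2 * ‖y - x‖ ^ 2)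
      - f (x + t • (y - x)))
      (1 * (f y - f x) - ((1 * (1 - 0) + 0 * (0 - 1)) * (m / 2 * ‖y - x‖ ^ 2))
        - 𝐃 f x (y - x)) 0 := by
    refine HasDerivAt.sub (HasDerivAt.sub ((hasDerivAt_id (0 : ℝ)).mul_const _) ?_) h1
    exact (HasDerivAt.mul (hasDerivAt_id (0 : ℝ))
      ((hasDerivAt_const (0 : ℝ) (1 : ℝ)).sub (hasDerivAt_id (0 : ℝ)))).mul_const _
  have h3 := h2.nonneg_of_eventually_le (by
    filter_upwards [Ioo_mem_nhdsGT (zero_lt_one' ℝ)] with t ht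
    have := hf.2 hx hy (sub_nonneg.2 ht.2.le) ht.1.le (sub_add_cancel 1 t)
    have e : (1 - t) • x + t • y = x + t • (y - x) := by module
    rw [e, norm_sub_rev] at this
    simp only [smul_eq_mul] at this
    simp only [zero_smul, add_zero, zero_mul]
    linarith)
  linarith

theorem StrongConvexOn.fderiv_sub_fderiv_ge (hf : StrongConvexOn s m f) (hx : x ∈ s) (hy : y ∈ s)
    (hdx : DifferentiableAt ℝ f x) (hdy : DifferentiableAt ℝ f y) :
    m * ‖y - x‖ ^ 2 ≤ (𝐃 f y - 𝐃 f x) (y - x) := by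
  have h1 := hf.add_fderiv_add_le hx hy hdx
  have h2 := hf.add_fderiv_add_le hy hx hdy
  rw [← neg_sub y x, map_neg, norm_neg] at h2
  rw [sub_apply]
  linarith

theorem StrongConvexOn.fderiv_fderiv_ge (hf : StrongConvexOn s m f) (hs : IsOpen s)
    (hd : DifferentiableOn ℝ f s) (hx : x ∈ s) (hd2 : DifferentiableAt ℝ (𝐃 f) x) (v : E) :
    m * ‖v‖ ^ 2 ≤ 𝐃 (𝐃 f) x v v := by
  have h1 := (hd2.hasFDerivAt.hasDerivAt_comp_line v).clm_apply (hasDerivAt_const (0 : ℝ) v)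
  have h2 := h1.sub ((hasDerivAt_id (0 : ℝ)).mul_const (m * ‖v‖ ^ 2))
  have h3 := h2.nonneg_of_eventually_le (by
    have hc : ContinuousAt (fun t : ℝ => x + t • v) 0 := by fun_prop
    have hm : ∀ᶠ t in 𝓝[>] (0 : ℝ), x + t • v ∈ s :=
      nhdsWithin_le_nhds (hc.eventually_mem (hs.mem_nhds (by simpa using hx)))
    filter_upwards [hm, self_mem_nhdsWithin] with t ht ht0
    have ht0' : (0 : ℝ) < t := ht0
    have := hf.fderiv_sub_fderiv_ge hx ht (hd.differentiableAt (hs.mem_nhds hx))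
      (hd.differentiableAt (hs.mem_nhds ht))
    simp only [add_sub_cancel_left, map_smul, norm_smul, sub_apply,
      smul_eq_mul, Real.norm_eq_abs, abs_of_pos ht0'] at this
    have h4 : t * (t * (m * ‖v‖ ^ 2)) ≤ t * (𝐃 f (x + t • v) v - 𝐃 f x v) := by nlinarith
    have h5 := le_of_mul_le_mul_left h4 ht0'
    simp only [Pi.sub_apply, id]
    simp
    linarith)
  simp at h3
  linarith

theorem StrongConvexOn.injOn_fderiv (hf : StrongConvexOn s m f) (hm : 0 < m) (hs : IsOpen s)
    (hd : DifferentiableOn ℝ f s) : InjOn (𝐃 f) s := by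
  intro x hx y hy h
  have := hf.fderiv_sub_fderiv_ge hx hy (hd.differentiableAt (hs.mem_nhds hx))
      (hd.differentiableAt (hs.mem_nhds hy))
  rw [h, sub_self, zero_apply] at this
  have h2 : ‖y - x‖ ^ 2 ≤ 0 := by
    by_contra! hc
    nlinarith
  have h3 : ‖y - x‖ = 0 := by
    have := sq_nonneg ‖y - x‖
    exact pow_eq_zero_iff (two_ne_zero) |>.1 (le_antisymm h2 this)
  exact (sub_eq_zero.1 (norm_eq_zero.1 h3)).symm

/-- On a ball around `c` the derivative of a strongly convex function attains all values close to
the value at `c`. -/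
theorem StrongConvexOn.exists_fderiv_eq [ProperSpace E] (hf : StrongConvexOn s m f)
    {c : E} {r : ℝ} (hr : 0 < r) (hcs : Metric.closedBall c r ⊆ s) (hs : IsOpen s)
    (hd : DifferentiableOn ℝ f s) (q : E →L[ℝ] ℝ) (hq : ‖𝐃 f c - q‖ < m / 2 * r) :
    ∃ w ∈ Metric.ball c r, 𝐃 f w = q := by
  have hc : c ∈ s := hcs (Metric.mem_closedBall_self hr.le)
  obtain ⟨w, hw, hmin⟩ := (isCompact_closedBall c r).exists_isMinOn
    ⟨c, Metric.mem_closedBall_self hr.le⟩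
    (f := fun z => f z - q z) ((hd.continuousOn.mono hcs).sub q.continuous.continuousOn)
  -- On the sphere of radius `r` the gain `m / 2 * r ^ 2` exceeds the possible loss `‖𝐃 f c - q‖ *
  -- r`, so the minimizer of `f - q` is interior.
  have hwb : w ∈ Metric.ball c r := by
    by_contra hcon
    have hn : ‖w - c‖ = r := by
      rw [Metric.mem_ball, not_lt] at hcon
      rw [← dist_eq_norm]
      exact le_antisymm hw hcon
    have h1 := hf.add_fderiv_add_le hc (hcs hw) (hd.differentiableAt (hs.mem_nhds hc))
    have h2 : f w - q w ≤ f c - q c := hmin (Metric.mem_closedBall_self hr.le)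
    have h3 := (𝐃 f c - q).le_opNorm (w - c)
    have h4 := neg_le_of_abs_le h3
    rw [sub_apply, map_sub q] at h4
    rw [hn] at h1 h4
    nlinarith
  refine ⟨w, hwb, ?_⟩
  have hloc : IsLocalMin (fun z => f z - q z) w :=
    hmin.isLocalMin (Metric.closedBall_mem_nhds_of_mem hwb)
  have h0 := hloc.fderiv_eq_zero
  rw [fderiv_fun_sub (hd.differentiableAt (hs.mem_nhds (hcs hw))) q.differentiableAt, q.fderiv] at h0
  exact sub_eq_zero.1 h0

end StrongConvexity

/-! ### Convexity of gradient images of small Euclidean balls. -/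

section ImageConvex

variable {E : Type*} [NormedAddCommGroup E] [InnerProductSpace ℝ E]
  {f : E → ℝ} {s : Set E} {m : ℝ}

theorem norm_lineMap_sub_sq {a b p : E} {t : ℝ} :
    ‖((1 - t) • a + t • b) - p‖ ^ 2
      = (1 - t) * ‖a - p‖ ^ 2 + t * ‖b - p‖ ^ 2 - t * (1 - t) * ‖a - b‖ ^ 2 := by
  have e1 : ((1 - t) • a + t • b) - p = (1 - t) • (a - p) + t • (b - p) := by module
  have e2 : a - b = (a - p) - (b - p) := by abel
  rw [e1, e2, norm_add_sq_real, norm_sub_sq_real (a - p), norm_smul, norm_smul, inner_smul_left,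
    inner_smul_right, mul_pow, mul_pow, Real.norm_eq_abs, Real.norm_eq_abs, sq_abs, sq_abs]
  simp
  ring

/-- A map with Lipschitz derivative deviates quadratically from affine interpolation. -/
theorem Convex.norm_image_lineMap_sub_le {F : Type*} [NormedAddCommGroup F] [NormedSpace ℝ F]
    {g : E → F} {K : ℝ} (hs : Convex ℝ s) (hg : ∀ x ∈ s, DifferentiableAt ℝ g x)
    (hg' : ∀ x ∈ s, DifferentiableAt ℝ (𝐃 g) x) (hK : ∀ x ∈ s, ‖𝐃 (𝐃 g) x‖ ≤ K)
    {a b : E} (ha : a ∈ s) (hb : b ∈ s) {t : ℝ} (ht : t ∈ Icc (0 : ℝ) 1) :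
    ‖g ((1 - t) • a + t • b) - ((1 - t) • g a + t • g b)‖ ≤ K * (t * (1 - t) * ‖a - b‖ ^ 2) := by
  set c := (1 - t) • a + t • b with hc
  have hcs : c ∈ s := hs ha hb (by linarith [ht.2]) ht.1 (by ring)
  have hK0 : 0 ≤ K := (norm_nonneg _).trans (hK a ha)
  have key : ∀ z ∈ s, ‖g z - g c - 𝐃 g c (z - c)‖ ≤ K * ‖z - c‖ * ‖z - c‖ := by
    intro z hz
    have hseg : segment ℝ c z ⊆ s := hs.segment_subset hcs hz
    refine Convex.norm_image_sub_le_of_norm_fderiv_le' (s := segment ℝ c z)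
      (fun x hx => hg x (hseg hx)) (fun x hx => ?_) (convex_segment c z)
      (left_mem_segment ℝ c z) (right_mem_segment ℝ c z)
    refine (Convex.norm_image_sub_le_of_norm_fderiv_le (s := segment ℝ c z)
      (fun x hx => hg' x (hseg hx)) (fun x hx => hK x (hseg hx)) (convex_segment c z)
      (left_mem_segment ℝ c z) hx).trans ?_
    refine mul_le_mul_of_nonneg_left ?_ hK0
    obtain ⟨θ, hθ, rfl⟩ := (segment_eq_image' ℝ c z ▸ hx : x ∈ _)
    simp only [add_sub_cancel_left, norm_smul, Real.norm_eq_abs, abs_of_nonneg hθ.1]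
    exact mul_le_of_le_one_left (norm_nonneg _) hθ.2
  have ka := key a ha
  have kb := key b hb
  have ea : a - c = t • (a - b) := by rw [hc]; module
  have eb : b - c = (-(1 - t)) • (a - b) := by rw [hc]; module
  -- The first order terms cancel, since `(1 - t) • (a - c) + t • (b - c) = 0`.
  have e : g c - ((1 - t) • g a + t • g b)
      = -((1 - t) • (g a - g c - 𝐃 g c (a - c)) + t • (g b - g c - 𝐃 g c (b - c))) := by
    rw [ea, eb, map_smul, map_smul]
    module
  have na : ‖a - c‖ = t * ‖a - b‖ := by
    rw [ea, norm_smul, Real.norm_eq_abs, abs_of_nonneg ht.1]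
  have nb : ‖b - c‖ = (1 - t) * ‖a - b‖ := by
    rw [eb, norm_smul, norm_neg, Real.norm_eq_abs, abs_of_nonneg (by linarith [ht.2])]
  rw [na] at ka
  rw [nb] at kb
  rw [e, norm_neg]
  refine (norm_add_le _ _).trans ?_
  rw [norm_smul, norm_smul, Real.norm_eq_abs, Real.norm_eq_abs, abs_of_nonneg ht.1,
    abs_of_nonneg (sub_nonneg.2 ht.2)]
  calc _ ≤ (1 - t) * (K * (t * ‖a - b‖) * (t * ‖a - b‖))
        + t * (K * ((1 - t) * ‖a - b‖) * ((1 - t) * ‖a - b‖)) :=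
        add_le_add (mul_le_mul_of_nonneg_left ka (sub_nonneg.2 ht.2))
          (mul_le_mul_of_nonneg_left kb ht.1)
    _ = _ := by ring

/-- The image of a small ball under the derivative of a strongly convex function is convex. -/
theorem StrongConvexOn.convex_image_fderiv_ball [FiniteDimensional ℝ E] (hf : StrongConvexOn s m f) (hm : 0 < m)
    (hs : IsOpen s) (hd : ContDiffOn ℝ 4 f s) {p : E} {r K : ℝ} (hps : Metric.ball p r ⊆ s)
    (hK : ∀ x ∈ Metric.ball p r, ‖𝐃 (𝐃 (𝐃 f)) x‖ ≤ K) (hr : 8 * K * r ≤ m) :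
    Convex ℝ (𝐃 f '' Metric.ball p r) := by
  rintro _ ⟨a, ha, rfl⟩ _ ⟨b, hb, rfl⟩ α t hα ht hαt
  obtain rfl : α = 1 - t := by linarith
  have hr0 : 0 < r := Metric.pos_of_mem_ball ha
  have hat : ∀ x ∈ Metric.ball p r, ContDiffAt ℝ 4 f x := fun x hx =>
    hd.contDiffAt (hs.mem_nhds (hps hx))
  have hat1 : ∀ x ∈ Metric.ball p r, ContDiffAt ℝ 3 (𝐃 f) x := fun x hx =>
    (hat x hx).fderiv_right (by norm_num)
  have hat2 : ∀ x ∈ Metric.ball p r, ContDiffAt ℝ 2 (𝐃 (𝐃 f)) x := fun x hx =>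
    (hat1 x hx).fderiv_right (by norm_num)
  -- In the degenerate case the interpolation error is zero, and the affine combination itself is
  -- the preimage.
  by_cases hab : t * (1 - t) * ‖a - b‖ ^ 2 = 0
  · have h := (convex_ball p r).norm_image_lineMap_sub_le
      (fun x hx => (hat1 x hx).differentiableAt (by norm_num))
      (fun x hx => (hat2 x hx).differentiableAt (by norm_num)) hK ha hb ⟨ht, by linarith⟩
    rw [hab, mul_zero] at h
    exact ⟨_, convex_ball p r ha hb hα ht hαt, sub_eq_zero.1 (norm_le_zero_iff.1 h)⟩
  have hpos : 0 < t * (1 - t) * ‖a - b‖ ^ 2 := lt_of_le_of_ne (by positivity) (Ne.symm hab)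
  set c := (1 - t) • a + t • b with hc
  set δ := t * (1 - t) * ‖a - b‖ ^ 2 with hδ
  have hcb : ‖c - p‖ ^ 2 < r ^ 2 - δ := by
    rw [hc, norm_lineMap_sub_sq]
    have h1 : ‖a - p‖ ^ 2 < r ^ 2 := by
      rw [← dist_eq_norm]; exact pow_lt_pow_left₀ ha dist_nonneg two_ne_zero
    have h2 : ‖b - p‖ ^ 2 < r ^ 2 := by
      rw [← dist_eq_norm]; exact pow_lt_pow_left₀ hb dist_nonneg two_ne_zero
    have h1t : 0 < 1 - t := by
      rcases hα.eq_or_lt with h | h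
      · exact absurd (by rw [hδ, ← h]; ring) hab
      · exact h
    nlinarith
  have hcr : ‖c - p‖ < r := by
    refine lt_of_pow_lt_pow_left₀ 2 hr0.le ?_
    linarith
  -- Uniform convexity of the ball leaves room `δ / (2 * r)` around `c`. The interpolation error is
  -- at most `K * δ`, and `8 * K * r ≤ m` makes it less than `m / 2` times this room, so the target
  -- gradient is attained there.
  have hcr2 : ‖c - p‖ + δ / (2 * r) < r := by
    have h1 : (r - ‖c - p‖) * (2 * r) > δ := by nlinarith [norm_nonneg (c - p)]
    have h2 : δ / (2 * r) < r - ‖c - p‖ := (div_lt_iff₀ (by positivity)).2 h1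
    linarith
  have hsub : Metric.closedBall c (δ / (2 * r)) ⊆ Metric.ball p r := by
    refine Metric.closedBall_subset_ball' ?_
    rw [dist_eq_norm]
    linarith
  have hest := (convex_ball p r).norm_image_lineMap_sub_le
      (fun x hx => (hat1 x hx).differentiableAt (by norm_num))
      (fun x hx => (hat2 x hx).differentiableAt (by norm_num)) hK ha hb ⟨ht, by linarith⟩
  obtain ⟨w, hw, hwe⟩ := hf.exists_fderiv_eq (c := c) (r := δ / (2 * r)) (by positivity)
    (hsub.trans hps) hs (hd.differentiableOn (by norm_num)) ((1 - t) • 𝐃 f a + t • 𝐃 f b) (by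
      refine lt_of_le_of_lt hest ?_
      have : m / 2 * (δ / (2 * r)) = δ * (m / (4 * r)) := by field_simp; ring
      rw [this, mul_comm]
      refine mul_lt_mul_of_pos_left ?_ hpos
      rw [lt_div_iff₀ (by positivity)]
      have hK0 : 0 ≤ K := (norm_nonneg _).trans (hK a ha)
      nlinarith)
  exact ⟨w, hsub (Metric.ball_subset_closedBall hw), hwe⟩

end ImageConvex

/-! ### The inverse of the gradient map. -/

section Inverse

variable {E : Type*} [NormedAddCommGroup E] [InnerProductSpace ℝ E]

/-- A coercive bilinear form on a finite-dimensional space, as a continuous equivalence with the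
dual space. -/
theorem exists_continuousLinearEquiv_of_coercive [FiniteDimensional ℝ E] {B : E →L[ℝ] E →L[ℝ] ℝ} {m : ℝ} (hm : 0 < m)
    (hB : ∀ v, m * ‖v‖ ^ 2 ≤ B v v) : ∃ e : E ≃L[ℝ] (E →L[ℝ] ℝ), (e : E →L[ℝ] E →L[ℝ] ℝ) = B := by
  have hinj : Function.Injective (B : E →ₗ[ℝ] E →L[ℝ] ℝ) := by
    refine (injective_iff_map_eq_zero _).2 fun v hv => ?_
    have hv' : B v = 0 := hv
    have := hB v
    rw [hv', zero_apply] at this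
    have h2 : ‖v‖ ^ 2 ≤ 0 := by
      by_contra! hc
      nlinarith
    exact norm_eq_zero.1 (pow_eq_zero_iff two_ne_zero |>.1 (le_antisymm h2 (sq_nonneg _)))
  have hfin : Module.finrank ℝ E = Module.finrank ℝ (E →L[ℝ] ℝ) :=
    (InnerProductSpace.toDual ℝ E).toLinearEquiv.finrank_eq
  refine ⟨(LinearMap.linearEquivOfInjective (B : E →ₗ[ℝ] E →L[ℝ] ℝ) hinj hfin).toContinuousLinearEquiv,
    ?_⟩
  ext v w
  simp

/-- The inverse of the derivative of `f` on `s` (the derivative of the Legendre transform). -/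
noncomputable def legendreInv (f : E → ℝ) (s : Set E) : (E →L[ℝ] ℝ) → E :=
  Function.invFunOn (𝐃 f) s

variable {f : E → ℝ} {s : Set E} {m : ℝ}

theorem legendreInv_mem {q : E →L[ℝ] ℝ} (hq : q ∈ 𝐃 f '' s) : legendreInv f s q ∈ s :=
  Function.invFunOn_mem hq

theorem fderiv_legendreInv {q : E →L[ℝ] ℝ} (hq : q ∈ 𝐃 f '' s) : 𝐃 f (legendreInv f s q) = q :=
  Function.invFunOn_eq hq

theorem legendreInv_fderiv (hf : InjOn (𝐃 f) s) {x : E} (hx : x ∈ s) :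
    legendreInv f s (𝐃 f x) = x :=
  hf (legendreInv_mem (mem_image_of_mem _ hx)) hx (fderiv_legendreInv (mem_image_of_mem _ hx))

/-- Coercivity makes the Hessian invertible, so the inverse function theorem applies; injectivity of
the gradient on `s` identifies the local inverse with `legendreInv`. -/
theorem StrongConvexOn.nhds_legendreInv [FiniteDimensional ℝ E] (hf : StrongConvexOn s m f) (hm : 0 < m)
    (hs : IsOpen s) (hd : ContDiffOn ℝ 4 f s) {q : E →L[ℝ] ℝ} (hq : q ∈ 𝐃 f '' s) :
    𝐃 f '' s ∈ 𝓝 q ∧ ContDiffAt ℝ 3 (legendreInv f s) q := by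
  obtain ⟨x, hx, rfl⟩ := hq
  have hat : ContDiffAt ℝ 3 (𝐃 f) x := (hd.contDiffAt (hs.mem_nhds hx)).fderiv_right (by norm_num)
  have hdo : DifferentiableOn ℝ f s := hd.differentiableOn (by norm_num)
  have hdiff : DifferentiableAt ℝ (𝐃 f) x := hat.differentiableAt (by norm_num)
  obtain ⟨e, he⟩ := exists_continuousLinearEquiv_of_coercive hm
    (hf.fderiv_fderiv_ge hs hdo hx hdiff)
  have hder : HasFDerivAt (𝐃 f) (e : E →L[ℝ] E →L[ℝ] ℝ) x := he ▸ hdiff.hasFDerivAt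
  have hstrict := hat.hasStrictFDerivAt' hder (by norm_num)
  refine ⟨?_, ?_⟩
  · rw [← hstrict.map_nhds_eq_of_equiv]
    exact image_mem_map (hs.mem_nhds hx)
  · refine (hat.to_localInverse hder (by norm_num)).congr_of_eventuallyEq ?_
    refine hstrict.localInverse_unique ?_
    filter_upwards [hs.mem_nhds hx] with z hz
    exact legendreInv_fderiv (hf.injOn_fderiv hm hs hdo) hz

end Inverse

/-! ### Symmetry of iterated derivatives, and the passage to `iteratedFDeriv`. -/

section Symmetry

variable {E : Type*} [NormedAddCommGroup E] [NormedSpace ℝ E]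
  {F : Type*} [NormedAddCommGroup F] [NormedSpace ℝ F]

theorem fderiv_apply_congr_of_eventually {g h : E → E →L[ℝ] F} {x : E}
    (hg : DifferentiableAt ℝ g x) (hh : DifferentiableAt ℝ h x) {b c : E}
    (hgh : ∀ᶠ y in 𝓝 x, g y b = h y c) (a : E) : 𝐃 g x a b = 𝐃 h x a c := by
  have h1 := hg.hasFDerivAt.clm_apply (hasFDerivAt_const b x)
  have h2 := hh.hasFDerivAt.clm_apply (hasFDerivAt_const c x)
  have h3 := h1.unique (h2.congr_of_eventuallyEq hgh)
  simpa using DFunLike.congr_fun h3 a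

theorem fderiv_apply_apply_congr_of_eventually {g : E → E →L[ℝ] E →L[ℝ] F} {x : E}
    (hg : DifferentiableAt ℝ g x) {b c b' c' : E}
    (hgh : ∀ᶠ y in 𝓝 x, g y b c = g y b' c') (a : E) : 𝐃 g x a b c = 𝐃 g x a b' c' := by
  have h1 (b : E) : HasFDerivAt (fun y => g y b) ((𝐃 g x).flip b) x := by
    refine (hg.hasFDerivAt.clm_apply (hasFDerivAt_const b x)).congr_fderiv ?_
    ext; simp
  have h2 := fderiv_apply_congr_of_eventually (h1 b).differentiableAt (h1 b').differentiableAt hgh a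
  simpa [(h1 b).fderiv, (h1 b').fderiv] using h2

variable {f : E → ℝ} {x : E}

theorem ContDiffAt.fderiv2_comm {G : Type*} [NormedAddCommGroup G] [NormedSpace ℝ G] {g : E → G}
    (h : ContDiffAt ℝ 2 g x) (a b : E) : 𝐃 (𝐃 g) x a b = 𝐃 (𝐃 g) x b a :=
  h.isSymmSndFDerivAt (by simp) a b

theorem ContDiffAt.fderiv3_comm_right {G : Type*} [NormedAddCommGroup G] [NormedSpace ℝ G]
    {g : E → G} (h : ContDiffAt ℝ 3 g x) (a b c : E) :
    𝐃 (𝐃 (𝐃 g)) x a b c = 𝐃 (𝐃 (𝐃 g)) x a c b := by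
  have h2 : ContDiffAt ℝ 1 (𝐃 (𝐃 g)) x :=
    ContDiffAt.fderiv_right (n := 2) (h.fderiv_right (by norm_num)) (by norm_num)
  refine fderiv_apply_apply_congr_of_eventually (h2.differentiableAt (by norm_num)) ?_ a
  filter_upwards [h.eventually (by norm_num)] with y hy
  exact (hy.of_le (by norm_num)).fderiv2_comm b c

theorem ContDiffAt.fderiv4_comm_right (h : ContDiffAt ℝ 4 f x) (a b c d : E) :
    𝐃 (𝐃 (𝐃 (𝐃 f))) x a b c d = 𝐃 (𝐃 (𝐃 (𝐃 f))) x a b d c := by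
  have h3 : ContDiffAt ℝ 1 (𝐃 (𝐃 (𝐃 f))) x :=
    ContDiffAt.fderiv_right (n := 2)
      (ContDiffAt.fderiv_right (n := 3) (h.fderiv_right (by norm_num)) (by norm_num)) (by norm_num)
  have hd := h3.differentiableAt (by norm_num)
  have h1 : HasFDerivAt (fun y => 𝐃 (𝐃 (𝐃 f)) y b) ((𝐃 (𝐃 (𝐃 (𝐃 f))) x).flip b) x := by
    refine (hd.hasFDerivAt.clm_apply (hasFDerivAt_const b x)).congr_fderiv ?_
    ext; simp
  have h2 := fderiv_apply_apply_congr_of_eventually h1.differentiableAt (b := c) (c := d) (b' := d)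
    (c' := c) (by
      filter_upwards [h.eventually (by norm_num)] with y hy
      exact (hy.of_le (by norm_num)).fderiv3_comm_right b c d) a
  simpa [h1.fderiv] using h2

/-- Differentiating along a curve puts its velocity in the first slots, whereas `antiBisectional`
has it in the last ones. -/
theorem ContDiffAt.fderiv4_comm_pairs (h : ContDiffAt ℝ 4 f x) (u v : E) :
    𝐃 (𝐃 (𝐃 (𝐃 f))) x v v u u = 𝐃 (𝐃 (𝐃 (𝐃 f))) x u u v v := by
  have h1 : ContDiffAt ℝ 3 (𝐃 f) x := h.fderiv_right (by norm_num)
  have h2 : ContDiffAt ℝ 2 (𝐃 (𝐃 f)) x := h1.fderiv_right (by norm_num)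
  rw [h1.fderiv3_comm_right v v u, h2.fderiv2_comm v u, h.fderiv4_comm_right u v v u,
    h1.fderiv3_comm_right u v u]

theorem iteratedFDeriv_two_eq (a b : E) :
    iteratedFDeriv ℝ 2 f x ![a, b] = 𝐃 (𝐃 f) x a b := by
  simp [iteratedFDeriv_succ_apply_right, iteratedFDeriv_zero_apply, Fin.init]

theorem iteratedFDeriv_three_eq (a b c : E) :
    iteratedFDeriv ℝ 3 f x ![a, b, c] = 𝐃 (𝐃 (𝐃 f)) x a b c := by
  rw [iteratedFDeriv_succ_apply_right, iteratedFDeriv_succ_apply_right, iteratedFDeriv_one_apply]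
  rfl

theorem iteratedFDeriv_four_eq (a b c d : E) :
    iteratedFDeriv ℝ 4 f x ![a, b, c, d] = 𝐃 (𝐃 (𝐃 (𝐃 f))) x a b c d := by
  rw [iteratedFDeriv_succ_apply_right, iteratedFDeriv_succ_apply_right,
    iteratedFDeriv_succ_apply_right, iteratedFDeriv_one_apply]
  rfl

theorem norm_fderiv2_eq : ‖𝐃 (𝐃 f) x‖ = ‖iteratedFDeriv ℝ 2 f x‖ := by
  rw [← norm_iteratedFDeriv_one, norm_iteratedFDeriv_fderiv]

theorem norm_fderiv3_eq : ‖𝐃 (𝐃 (𝐃 f)) x‖ = ‖iteratedFDeriv ℝ 3 f x‖ := by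
  rw [← norm_iteratedFDeriv_one, norm_iteratedFDeriv_fderiv, norm_iteratedFDeriv_fderiv]

theorem norm_fderiv4_eq : ‖𝐃 (𝐃 (𝐃 (𝐃 f))) x‖ = ‖iteratedFDeriv ℝ 4 f x‖ := by
  rw [← norm_iteratedFDeriv_one, norm_iteratedFDeriv_fderiv, norm_iteratedFDeriv_fderiv,
    norm_iteratedFDeriv_fderiv]

end Symmetry

/-! ### Curves with affine gradient and the variation formula. -/

section LegendreCurve

variable {E : Type*} [NormedAddCommGroup E] [InnerProductSpace ℝ E] [FiniteDimensional ℝ E]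
  {f : E → ℝ} {s : Set E} {m : ℝ}

/-- The curve along which the derivative of `f` runs along the line `t ↦ q + t • η`. -/
noncomputable def legendreCurve (f : E → ℝ) (s : Set E) (q η : E →L[ℝ] ℝ) (t : ℝ) : E :=
  legendreInv f s (q + t • η)

/-- The last two fields are the first and second derivatives of `𝐃 f (w r) = q + r • η`. The second
one expresses `w''` through the inverse Hessian, which is how `Ψ^{pq}` enters the curvature. The
first field holds near `t` so that functions of `w` can be differentiated twice. -/
structure IsLegendreCurveAt (f : E → ℝ) (η : E →L[ℝ] ℝ) (w w' : ℝ → E) (w'' : E) (t : ℝ) :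
    Prop where
  hasDerivAt : ∀ᶠ r in 𝓝 t, HasDerivAt w (w' r) r
  hasDerivAt_deriv : HasDerivAt w' w'' t
  fderiv2_apply : 𝐃 (𝐃 f) (w t) (w' t) = η
  fderiv3_add : 𝐃 (𝐃 (𝐃 f)) (w t) (w' t) (w' t) + 𝐃 (𝐃 f) (w t) w'' = 0

theorem StrongConvexOn.isLegendreCurveAt (hf : StrongConvexOn s m f) (hm : 0 < m)
    (hs : IsOpen s) (hd : ContDiffOn ℝ 4 f s) {q η : E →L[ℝ] ℝ} {t : ℝ}
    (ht : q + t • η ∈ 𝐃 f '' s) :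
    (∀ᶠ r in 𝓝 t, q + r • η ∈ 𝐃 f '' s) ∧
    IsLegendreCurveAt f η (legendreCurve f s q η) (deriv (legendreCurve f s q η))
      (deriv (deriv (legendreCurve f s q η)) t) t := by
  set w := legendreCurve f s q η with hw
  obtain ⟨hn, hc⟩ := hf.nhds_legendreInv hm hs hd ht
  have hline : ∀ r : ℝ, HasDerivAt (fun r : ℝ => q + r • η) η r := fun r => by
    simpa using ((hasDerivAt_id r).smul_const η).const_add q
  have hev : ∀ᶠ r in 𝓝 t, q + r • η ∈ 𝐃 f '' s :=
    (hline t).continuousAt.eventually_mem hn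
  have hwc : ContDiffAt ℝ 3 w t :=
    ContDiffAt.comp (f := fun r : ℝ => q + r • η) t hc (by fun_prop)
  have hd1 : ∀ᶠ r in 𝓝 t, HasDerivAt w (deriv w r) r := by
    filter_upwards [hwc.eventually (by norm_num)] with r hr
    exact (hr.differentiableAt (by norm_num)).hasDerivAt
  have hd2 : HasDerivAt (deriv w) (deriv (deriv w) t) t := by
    have h1 : ContDiffAt ℝ 2 (fderiv ℝ w) t := hwc.fderiv_right (by norm_num)
    have h2 : DifferentiableAt ℝ (deriv w) t := by
      have h3 := h1.differentiableAt (by norm_num)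
      exact h3.clm_apply (differentiableAt_const 1)
    exact h2.hasDerivAt
  have hat : ∀ {r}, q + r • η ∈ 𝐃 f '' s → ContDiffAt ℝ 3 (𝐃 f) (w r) := fun {r} hr =>
    (hd.contDiffAt (hs.mem_nhds (legendreInv_mem hr))).fderiv_right (by norm_num)
  have heq : ∀ᶠ r in 𝓝 t, 𝐃 (𝐃 f) (w r) (deriv w r) = η := by
    filter_upwards [hev, hev.eventually_nhds, hd1] with r hr hr' hdr
    have h1 := ((hat hr).differentiableAt (by norm_num)).hasFDerivAt.comp_hasDerivAt r hdr
    refine h1.unique ((hline r).congr_of_eventuallyEq ?_)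
    filter_upwards [hr'] with r' hr''
    exact fderiv_legendreInv hr''
  refine ⟨hev, hd1, hd2, heq.self_of_nhds, ?_⟩
  have h2 : ContDiffAt ℝ 2 (𝐃 (𝐃 f)) (w t) := (hat ht).fderiv_right (by norm_num)
  have h3 := (h2.differentiableAt (by norm_num)).hasFDerivAt.comp_hasDerivAt t hd1.self_of_nhds
  exact (h3.clm_apply hd2).unique ((hasDerivAt_const t η).congr_of_eventuallyEq heq)

omit [FiniteDimensional ℝ E] in
/-- The first two derivatives of `-f_{uu} - f_a` along a Legendre curve; the second one is an
anti-bisectional curvature. -/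
theorem IsLegendreCurveAt.hasDerivAt_second_variation {w w' : ℝ → E} {w'' : E} {η : E →L[ℝ] ℝ}
    {t : ℝ} (h : IsLegendreCurveAt f η w w' w'' t) (hf : ContDiffAt ℝ 4 f (w t)) (u a : E) :
    (∀ᶠ r in 𝓝 t, HasDerivAt (fun r => -𝐃 (𝐃 f) (w r) u u - 𝐃 f (w r) a)
      (-𝐃 (𝐃 (𝐃 f)) (w r) (w' r) u u - 𝐃 (𝐃 f) (w r) (w' r) a) r) ∧
    HasDerivAt (fun r => -𝐃 (𝐃 (𝐃 f)) (w r) (w' r) u u - 𝐃 (𝐃 f) (w r) (w' r) a)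
      (-𝐃 (𝐃 (𝐃 (𝐃 f))) (w t) (w' t) (w' t) u u - 𝐃 (𝐃 (𝐃 f)) (w t) w'' u u) t := by
  have hcont : ContinuousAt w t := h.hasDerivAt.self_of_nhds.continuousAt
  have key : ∀ {r}, ContDiffAt ℝ 4 f (w r) → DifferentiableAt ℝ (𝐃 f) (w r) ∧
      DifferentiableAt ℝ (𝐃 (𝐃 f)) (w r) ∧ DifferentiableAt ℝ (𝐃 (𝐃 (𝐃 f))) (w r) := by
    intro r hr
    have h1 : ContDiffAt ℝ 3 (𝐃 f) (w r) := hr.fderiv_right (by norm_num)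
    have h2 : ContDiffAt ℝ 2 (𝐃 (𝐃 f)) (w r) := h1.fderiv_right (by norm_num)
    have h3 : ContDiffAt ℝ 1 (𝐃 (𝐃 (𝐃 f))) (w r) := h2.fderiv_right (by norm_num)
    exact ⟨h1.differentiableAt (by norm_num), h2.differentiableAt (by norm_num),
      h3.differentiableAt (by norm_num)⟩
  constructor
  · filter_upwards [h.hasDerivAt, hcont.eventually (hf.eventually (by norm_num))] with r hr hfr
    obtain ⟨k1, k2, -⟩ := key hfr
    have e1 := k1.hasFDerivAt.comp_hasDerivAt r hr
    have e2 := k2.hasFDerivAt.comp_hasDerivAt r hr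
    have e3 := ((e2.clm_apply (hasDerivAt_const r u)).clm_apply (hasDerivAt_const r u)).neg.sub
      (e1.clm_apply (hasDerivAt_const r a))
    refine e3.congr_deriv ?_
    simp
  · obtain ⟨-, k2, k3⟩ := key hf
    have hr := h.hasDerivAt.self_of_nhds
    have e2 := k2.hasFDerivAt.comp_hasDerivAt t hr
    have e3 := k3.hasFDerivAt.comp_hasDerivAt t hr
    have e4 := (((e3.clm_apply h.hasDerivAt_deriv).clm_apply (hasDerivAt_const t u)).clm_apply
      (hasDerivAt_const t u)).neg.sub
      ((e2.clm_apply h.hasDerivAt_deriv).clm_apply (hasDerivAt_const t a))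
    refine e4.congr_deriv ?_
    -- The `a`-part drops out: `𝐃 f (w r) a` is affine in `r`.
    have := DFunLike.congr_fun h.fderiv3_add a
    simp at this ⊢
    linarith

end LegendreCurve

/-! ### The anti-bisectional curvature without coordinates. -/

section Curvature

variable {n : ℕ} {Ψ : EuclideanSpace ℝ (Fin n) → ℝ} {x : EuclideanSpace ℝ (Fin n)}

theorem EuclideanSpace.eq_sum_single (b : EuclideanSpace ℝ (Fin n)) :
    b = ∑ p, b p • EuclideanSpace.single p (1 : ℝ) := by
  ext i
  simp [Finset.sum_apply, Pi.single_apply]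

theorem hessianMatrix_mulVec (h : ContDiffAt ℝ 4 Ψ x) (b : EuclideanSpace ℝ (Fin n)) (i : Fin n) :
    (hessianMatrix Ψ x).mulVec b i = 𝐃 (𝐃 Ψ) x b (EuclideanSpace.single i 1) := by
  rw [(h.of_le (by norm_num)).fderiv2_comm b]
  conv_rhs => rw [EuclideanSpace.eq_sum_single b]
  simp only [map_sum, map_smul, smul_eq_mul, Matrix.mulVec, dotProduct, hessianMatrix,
    Matrix.of_apply, iteratedFDeriv_two_eq]
  exact Finset.sum_congr rfl fun j _ => mul_comm _ _

theorem isUnit_det_hessianMatrix {m : ℝ} (hm : 0 < m) (h : ContDiffAt ℝ 4 Ψ x)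
    (hpos : ∀ v, m * ‖v‖ ^ 2 ≤ 𝐃 (𝐃 Ψ) x v v) : IsUnit (hessianMatrix Ψ x).det := by
  rw [← Matrix.isUnit_iff_isUnit_det, ← Matrix.mulVec_injective_iff_isUnit]
  refine (injective_iff_map_eq_zero (hessianMatrix Ψ x).mulVecLin).2 fun b hb => ?_
  obtain ⟨b, rfl⟩ : ∃ b' : EuclideanSpace ℝ (Fin n), (b' : Fin n → ℝ) = b := ⟨WithLp.toLp 2 b, rfl⟩
  have h0 : 𝐃 (𝐃 Ψ) x b b = 0 := by
    conv_lhs => rw [EuclideanSpace.eq_sum_single b]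
    rw [← EuclideanSpace.eq_sum_single b, EuclideanSpace.eq_sum_single b, map_sum]
    refine Finset.sum_eq_zero fun i _ => ?_
    rw [← EuclideanSpace.eq_sum_single b, map_smul, ← hessianMatrix_mulVec h]
    have := congrFun hb i
    simp only [Matrix.mulVecLin_apply, Pi.zero_apply] at this
    rw [this, smul_zero]
  have h1 := hpos b
  rw [h0] at h1
  have h2 : ‖b‖ ^ 2 ≤ 0 := by
    by_contra! hc
    nlinarith
  have h3 : b = 0 := norm_eq_zero.1 (pow_eq_zero_iff two_ne_zero |>.1 (le_antisymm h2 (sq_nonneg _)))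
  rw [h3]
  rfl

/-- The anti-bisectional curvature with the inverse Hessian expressed through the solution `b` of
`Ψ_{b·} = -Ψ_{vv·}`. -/
theorem antiBisectional_eq {m : ℝ} (hm : 0 < m) (h : ContDiffAt ℝ 4 Ψ x)
    (hpos : ∀ v, m * ‖v‖ ^ 2 ≤ 𝐃 (𝐃 Ψ) x v v) {u v b : EuclideanSpace ℝ (Fin n)}
    (hb : 𝐃 (𝐃 (𝐃 Ψ)) x v v + 𝐃 (𝐃 Ψ) x b = 0) :
    antiBisectional Ψ x u v = -𝐃 (𝐃 (𝐃 (𝐃 Ψ))) x v v u u - 𝐃 (𝐃 (𝐃 Ψ)) x b u u := by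
  have h1 : ContDiffAt ℝ 3 (𝐃 Ψ) x := h.fderiv_right (by norm_num)
  have hdet := isUnit_det_hessianMatrix hm h hpos
  set d : Fin n → ℝ := fun q => 𝐃 (𝐃 (𝐃 Ψ)) x v v (EuclideanSpace.single q 1) with hdd
  have hHb : (hessianMatrix Ψ x).mulVec b = -d := by
    ext i
    have := DFunLike.congr_fun hb (EuclideanSpace.single i (1 : ℝ))
    simp only [add_apply, zero_apply] at this
    rw [hessianMatrix_mulVec h, Pi.neg_apply, hdd]
    linarith
  have hbd : ∀ p, b p = -(hessianMatrix Ψ x)⁻¹.mulVec d p := by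
    intro p
    have h2 : (hessianMatrix Ψ x)⁻¹.mulVec ((hessianMatrix Ψ x).mulVec b) = b := by
      rw [Matrix.mulVec_mulVec, Matrix.nonsing_inv_mul _ hdet, Matrix.one_mulVec]
    rw [hHb, Matrix.mulVec_neg] at h2
    exact (congrFun h2 p).symm
  have h3 : 𝐃 (𝐃 (𝐃 Ψ)) x b u u
      = ∑ p, b p * 𝐃 (𝐃 (𝐃 Ψ)) x u u (EuclideanSpace.single p 1) := by
    rw [ContDiffAt.fderiv2_comm (h1.of_le (by norm_num)) b u,
      ContDiffAt.fderiv3_comm_right (h.of_le (by norm_num)) u b u]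
    conv_lhs => rw [EuclideanSpace.eq_sum_single b]
    simp only [map_sum, map_smul, smul_eq_mul]
  rw [antiBisectional, iteratedFDeriv_four_eq, h.fderiv4_comm_pairs u v, h3]
  simp only [iteratedFDeriv_three_eq]
  rw [sub_eq_add_neg, ← Finset.sum_neg_distrib]
  congr 1
  refine Finset.sum_congr rfl fun p _ => ?_
  rw [hbd p, Matrix.mulVec, dotProduct, neg_mul, neg_neg, Finset.sum_mul]
  refine Finset.sum_congr rfl fun q _ => ?_
  rw [hdd]
  ring

end Curvature

/-! ### Inequalities for functions of one variable. -/

section OneVariable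

/-- A function with `f'' ≥ -C |f'|` on `[0,1]` is quantitatively quasiconvex. -/
theorem sub_le_exp_mul_max_of_deriv2_ge {f f' f'' : ℝ → ℝ} {C : ℝ} (hC : 0 ≤ C)
    (hf : ∀ t ∈ Icc (0 : ℝ) 1, HasDerivAt f (f' t) t)
    (hf' : ∀ t ∈ Icc (0 : ℝ) 1, HasDerivAt f' (f'' t) t)
    (h : ∀ t ∈ Icc (0 : ℝ) 1, -(C * |f' t|) ≤ f'' t) {t : ℝ} (ht : t ∈ Icc (0 : ℝ) 1) :
    f t - f 0 ≤ Real.exp (C + 1) * t * max (f 1 - f 0) 0 := by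
  have hexp : 0 < Real.exp (C + 1) := Real.exp_pos _
  rcases le_or_gt (f t - f 0) 0 with h0 | h0
  · exact h0.trans (mul_nonneg (mul_nonneg hexp.le ht.1) (le_max_right _ _))
  have ht0 : 0 < t := by
    rcases ht.1.eq_or_lt with h1 | h1
    · rw [← h1, sub_self] at h0
      exact absurd h0 (lt_irrefl _)
    · exact h1
  have hcont : ContinuousOn f (Icc 0 1) := fun r hr => (hf r hr).continuousAt.continuousWithinAt
  obtain ⟨r, hr, hre⟩ := exists_hasDerivAt_eq_slope f f' ht0
    (hcont.mono (Icc_subset_Icc_right ht.2)) fun r hr => hf r ⟨hr.1.le, hr.2.le.trans ht.2⟩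
  have hr1 : r ≤ 1 := hr.2.le.trans ht.2
  have hfr : 0 < f' r := by rw [hre]; exact div_pos h0 (by linarith)
  have hΔ : f t - f 0 = f' r * t := by rw [hre, sub_zero, div_mul_cancel₀ _ ht0.ne']
  -- A positive slope at `r` decays at most exponentially. The rate is `C + 1` rather than `C`
  -- because the comparison needs a strict inequality at contact points.
  have hgrow : ∀ σ ∈ Icc r 1, f' r * Real.exp (-(C + 1) * (σ - r)) ≤ f' σ := by
    intro σ hσ
    have hB : ∀ x, HasDerivAt (fun x => -(f' r * Real.exp (-(C + 1) * (x - r))))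
        (-(f' r * (Real.exp (-(C + 1) * (x - r)) * (-(C + 1))))) x := fun x => by
      have h1 : HasDerivAt (fun x => -(C + 1) * (x - r)) (-(C + 1)) x := by
        simpa using ((hasDerivAt_id x).sub_const r).const_mul (-(C + 1))
      exact (h1.exp.const_mul (f' r)).neg
    have hmem : ∀ x ∈ Icc r 1, x ∈ Icc (0 : ℝ) 1 := fun x hx => ⟨hr.1.le.trans hx.1, hx.2⟩
    have := image_le_of_deriv_right_lt_deriv_boundary' (f := fun x => -f' x)
      (f' := fun x => -f'' x) (a := r) (b := 1)
      (fun x hx => (hf' x (hmem x hx)).neg.continuousAt.continuousWithinAt)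
      (fun x hx => (hf' x (hmem x ⟨hx.1, hx.2.le⟩)).neg.hasDerivWithinAt)
      (B := fun x => -(f' r * Real.exp (-(C + 1) * (x - r)))) (by simp)
      (fun x _ => (hB x).continuousAt.continuousWithinAt)
      (fun x _ => (hB x).hasDerivWithinAt) (fun x hx hxe => by
        have hxe' : f' x = f' r * Real.exp (-(C + 1) * (x - r)) := neg_injective hxe
        have hpos : 0 < f' x := by rw [hxe']; positivity
        have h2 := h x (hmem x ⟨hx.1, hx.2.le⟩)
        rw [abs_of_pos hpos] at h2
        have h3 : -(f' r * (Real.exp (-(C + 1) * (x - r)) * (-(C + 1)))) = (C + 1) * f' x := by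
          rw [hxe']; ring
        rw [h3]
        linarith) hσ
    exact neg_le_neg_iff.1 this
  have hlow : ∀ σ ∈ Icc r 1, f' r * Real.exp (-(C + 1)) ≤ f' σ := fun σ hσ => by
    refine le_trans ?_ (hgrow σ hσ)
    refine mul_le_mul_of_nonneg_left (Real.exp_le_exp.2 ?_) hfr.le
    nlinarith [hσ.1, hσ.2, hr.1]
  have hend : f' r * Real.exp (-(C + 1)) * (1 - t) ≤ f 1 - f t := by
    rcases ht.2.eq_or_lt with h1 | h1
    · rw [h1]; simp
    obtain ⟨σ, hσ, hσe⟩ := exists_hasDerivAt_eq_slope f f' h1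
      (hcont.mono (Icc_subset_Icc_left ht.1)) fun r hr => hf r ⟨ht.1.trans hr.1.le, hr.2.le⟩
    have := hlow σ ⟨hr.2.le.trans hσ.1.le, hσ.2.le⟩
    rw [hσe, le_div_iff₀ (by linarith)] at this
    exact this
  have he1 : Real.exp (-(C + 1)) ≤ 1 := Real.exp_le_one_iff.2 (by linarith)
  have hfin : f' r * Real.exp (-(C + 1)) ≤ f 1 - f 0 := by
    have : f' r * Real.exp (-(C + 1)) * t ≤ f' r * t := by
      have : f' r * Real.exp (-(C + 1)) ≤ f' r := mul_le_of_le_one_right hfr.le he1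
      exact mul_le_mul_of_nonneg_right this ht.1
    linarith
  calc f t - f 0 = Real.exp (C + 1) * t * (f' r * Real.exp (-(C + 1))) := by
        rw [hΔ, Real.exp_neg]; field_simp
    _ ≤ _ := mul_le_mul_of_nonneg_left (hfin.trans (le_max_left _ _)) (by positivity)

theorem sub_ge_of_deriv2_ge {g g' g'' : ℝ → ℝ} {c : ℝ} (hc : 0 ≤ c)
    (hg : ∀ t ∈ Icc (0 : ℝ) 1, HasDerivAt g (g' t) t)
    (hg' : ∀ t ∈ Icc (0 : ℝ) 1, HasDerivAt g' (g'' t) t) (h0 : g' 0 = 0)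
    (h : ∀ t ∈ Icc (0 : ℝ) 1, -c ≤ g'' t) : -c ≤ g 1 - g 0 := by
  obtain ⟨σ, hσ, hσe⟩ := exists_hasDerivAt_eq_slope g g' zero_lt_one
    (fun r hr => (hg r hr).continuousAt.continuousWithinAt) fun r hr => hg r ⟨hr.1.le, hr.2.le⟩
  obtain ⟨τ, hτ, hτe⟩ := exists_hasDerivAt_eq_slope g' g'' hσ.1
    (fun r hr => (hg' r ⟨hr.1, hr.2.trans hσ.2.le⟩).continuousAt.continuousWithinAt)
    fun r hr => hg' r ⟨hr.1.le, hr.2.le.trans hσ.2.le⟩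
  have h1 := h τ ⟨hτ.1.le, hτ.2.le.trans hσ.2.le⟩
  rw [hτe, h0, sub_zero, sub_zero, le_div_iff₀ hσ.1] at h1
  rw [sub_zero, div_one] at hσe
  rw [← hσe]
  nlinarith [hσ.1, hσ.2]

/-- Strict version of the second derivative test. -/
theorem eventually_lt_of_deriv2_neg {g g' : ℝ → ℝ} {g'' : ℝ}
    (hg : ∀ᶠ t in 𝓝 (0 : ℝ), HasDerivAt g (g' t) t) (hg' : HasDerivAt g' g'' 0) (h0 : g' 0 = 0)
    (h : g'' < 0) : ∀ᶠ t in 𝓝 (0 : ℝ), t ≠ 0 → g t < g 0 := by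
  -- The correction leaves second derivative `g'' / 2 < 0`, so `k` still has a local maximum; its
  -- positive quadratic term makes the inequality for `g` strict.
  set k : ℝ → ℝ := fun t => g t + (-g'' / 4) * t ^ 2 with hk
  have hk1 : ∀ᶠ t in 𝓝 (0 : ℝ), HasDerivAt k (g' t + (-g'' / 4) * (2 * t)) t := by
    filter_upwards [hg] with t ht
    have := ht.add ((hasDerivAt_pow 2 t).const_mul (-g'' / 4))
    simp only [Nat.cast_ofNat, Nat.add_one_sub_one, pow_one] at this
    exact this
  have hk2 : deriv k =ᶠ[𝓝 0] fun t => g' t + (-g'' / 4) * (2 * t) := by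
    filter_upwards [hk1] with t ht using ht.deriv
  have hk3 : HasDerivAt (fun t => g' t + (-g'' / 4) * (2 * t)) (g'' + (-g'' / 4) * (2 * 1)) 0 :=
    hg'.add (((hasDerivAt_id (0 : ℝ)).const_mul 2).const_mul (-g'' / 4))
  have hmax : IsLocalMax k 0 := by
    refine isLocalMax_of_deriv_deriv_neg ?_ ?_ hk1.self_of_nhds.continuousAt
    · rw [hk2.deriv_eq, hk3.deriv]
      linarith
    · rw [hk2.self_of_nhds]
      simp [h0]
  filter_upwards [hmax] with t ht ht0
  have h1 : 0 < t ^ 2 := by positivity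
  simp only [hk] at ht
  nlinarith

end OneVariable

/-! ### From orthogonal pairs to a lower bound on all pairs. -/

section CurvatureBound

variable {n : ℕ} {Ψ : EuclideanSpace ℝ (Fin n) → ℝ} {x : EuclideanSpace ℝ (Fin n)}

theorem mul_norm_le_of_coercive {E : Type*} [NormedAddCommGroup E] [NormedSpace ℝ E]
    {B : E →L[ℝ] E →L[ℝ] ℝ} {m : ℝ} (hB : ∀ v, m * ‖v‖ ^ 2 ≤ B v v) (v : E) :
    m * ‖v‖ ≤ ‖B v‖ := by
  rcases (norm_nonneg v).eq_or_lt with h | h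
  · rw [← h, mul_zero]; exact norm_nonneg _
  have h1 := (le_abs_self _).trans ((B v).le_opNorm v)
  have h2 := hB v
  refine le_of_mul_le_mul_right ?_ h
  nlinarith

theorem abs_apply_apply_le_of_norm_le {E : Type*} [NormedAddCommGroup E] [NormedSpace ℝ E]
    {B : E →L[ℝ] E →L[ℝ] ℝ} {K : ℝ} (hB : ‖B‖ ≤ K) (u v : E) : |B u v| ≤ K * ‖u‖ * ‖v‖ := by
  rw [← Real.norm_eq_abs]
  refine (B.le_opNorm₂ u v).trans ?_
  gcongr

/-- If the curvature is nonnegative on orthogonal pairs, its negative part on a general pair is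
controlled by `Ψ_{uv}`. -/
theorem antiBisectional_ge {m C : ℝ} (hm : 0 < m) (h : ContDiffAt ℝ 4 Ψ x)
    (hpos : ∀ v, m * ‖v‖ ^ 2 ≤ 𝐃 (𝐃 Ψ) x v v) (hC2 : ‖𝐃 (𝐃 Ψ) x‖ ≤ C)
    (hC3 : ‖𝐃 (𝐃 (𝐃 Ψ)) x‖ ≤ C) (hC4 : ‖𝐃 (𝐃 (𝐃 (𝐃 Ψ))) x‖ ≤ C)
    (hN : ∀ u v, iteratedFDeriv ℝ 2 Ψ x ![u, v] = 0 → 0 ≤ antiBisectional Ψ x u v)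
    (u v : EuclideanSpace ℝ (Fin n)) :
    -((C + C ^ 2 / m) * (2 + C / m) / m * |𝐃 (𝐃 Ψ) x u v| * ‖u‖ * ‖v‖)
      ≤ antiBisectional Ψ x u v := by
  have hC0 : 0 ≤ C := (norm_nonneg _).trans hC2
  rcases eq_or_ne u 0 with rfl | hu
  · have := hN 0 v (by simp [iteratedFDeriv_two_eq])
    simpa using this
  have hu0 : 0 < ‖u‖ := norm_pos_iff.2 hu
  have huu : 0 < 𝐃 (𝐃 Ψ) x u u := lt_of_lt_of_le (by positivity) (hpos u)
  obtain ⟨e, he⟩ := exists_continuousLinearEquiv_of_coercive hm hpos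
  have hsolve : ∀ v, ∃ b, 𝐃 (𝐃 (𝐃 Ψ)) x v v + 𝐃 (𝐃 Ψ) x b = 0 := fun v => by
    refine ⟨e.symm (-𝐃 (𝐃 (𝐃 Ψ)) x v v), ?_⟩
    rw [← he]
    simp
  set a := 𝐃 (𝐃 Ψ) x u v with ha
  -- The component of `v` along `u` for the Hessian metric, of size at most `|Ψ_{uv}| / (m ‖u‖)`. As
  -- `𝔄(u,·)` is quadratic, removing it costs at most a multiple of `‖d‖ * (‖v‖ + ‖v'‖) * ‖u‖ ^ 2`.
  set d := (a / 𝐃 (𝐃 Ψ) x u u) • u with hd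
  set v' := v - d with hv'
  obtain ⟨b, hb⟩ := hsolve v
  obtain ⟨b', hb'⟩ := hsolve v'
  have horth : 𝐃 (𝐃 Ψ) x u v' = 0 := by
    rw [hv', hd, map_sub, map_smul, smul_eq_mul, div_mul_cancel₀ _ huu.ne', ← ha, sub_self]
  have hA' := hN u v' (by rw [iteratedFDeriv_two_eq, horth])
  rw [antiBisectional_eq hm h hpos hb'] at hA'
  rw [antiBisectional_eq hm h hpos hb]
  have hdn : m * ‖u‖ * ‖d‖ ≤ |a| := by
    rw [hd, norm_smul, norm_div, Real.norm_eq_abs, Real.norm_eq_abs, abs_of_pos huu]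
    have h1 := hpos u
    have : m * ‖u‖ * (|a| / 𝐃 (𝐃 Ψ) x u u * ‖u‖) = |a| * (m * ‖u‖ ^ 2) / 𝐃 (𝐃 Ψ) x u u := by ring
    rw [this, div_le_iff₀ huu]
    exact mul_le_mul_of_nonneg_left h1 (abs_nonneg _)
  have hau : |a| ≤ C * ‖u‖ * ‖v‖ := abs_apply_apply_le_of_norm_le hC2 u v
  have hdv : ‖d‖ ≤ C / m * ‖v‖ := by
    have h1 : ‖u‖ * (m * ‖d‖) ≤ ‖u‖ * (C * ‖v‖) := by linarith
    have h2 := le_of_mul_le_mul_left h1 hu0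
    rw [div_mul_eq_mul_div, le_div_iff₀ hm]
    linarith
  have hS : ‖v‖ + ‖v'‖ ≤ (2 + C / m) * ‖v‖ := by
    have : ‖v'‖ ≤ ‖v‖ + ‖d‖ := norm_sub_le _ _
    linarith
  set S := ‖v‖ + ‖v'‖ with hSdef
  have hS0 : 0 ≤ S := by positivity
  have hvd : v = v' + d := by rw [hv']; abel
  have h4 : |𝐃 (𝐃 (𝐃 (𝐃 Ψ))) x v v u u - 𝐃 (𝐃 (𝐃 (𝐃 Ψ))) x v' v' u u|
      ≤ C * ‖d‖ * S * ‖u‖ ^ 2 := by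
    have e1 : 𝐃 (𝐃 (𝐃 (𝐃 Ψ))) x v v u u - 𝐃 (𝐃 (𝐃 (𝐃 Ψ))) x v' v' u u
        = (𝐃 (𝐃 (𝐃 (𝐃 Ψ))) x d v + 𝐃 (𝐃 (𝐃 (𝐃 Ψ))) x v' d) u u := by
      have : 𝐃 (𝐃 (𝐃 (𝐃 Ψ))) x v v = 𝐃 (𝐃 (𝐃 (𝐃 Ψ))) x v' v' + 𝐃 (𝐃 (𝐃 (𝐃 Ψ))) x v' d
          + 𝐃 (𝐃 (𝐃 (𝐃 Ψ))) x d v := by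
        conv_lhs => rw [hvd, map_add (𝐃 (𝐃 (𝐃 (𝐃 Ψ))) x), add_apply, map_add (𝐃 (𝐃 (𝐃 (𝐃 Ψ))) x v')]
        rw [← hvd]
      rw [this]
      simp only [add_apply]
      ring
    have e2 : ‖𝐃 (𝐃 (𝐃 (𝐃 Ψ))) x d v + 𝐃 (𝐃 (𝐃 (𝐃 Ψ))) x v' d‖ ≤ C * ‖d‖ * S := by
      refine (norm_add_le _ _).trans ?_
      have a1 := (𝐃 (𝐃 (𝐃 (𝐃 Ψ))) x).le_opNorm₂ d v
      have a2 := (𝐃 (𝐃 (𝐃 (𝐃 Ψ))) x).le_opNorm₂ v' d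
      have a3 : ‖𝐃 (𝐃 (𝐃 (𝐃 Ψ))) x‖ * (‖d‖ * S) ≤ C * (‖d‖ * S) := by gcongr
      rw [hSdef] at a3 ⊢
      linarith
    rw [e1, sq, ← mul_assoc]
    exact abs_apply_apply_le_of_norm_le e2 u u
  have h3 : m * ‖b - b'‖ ≤ C * ‖d‖ * S := by
    have e1 : 𝐃 (𝐃 Ψ) x (b - b') = -(𝐃 (𝐃 (𝐃 Ψ)) x d v + 𝐃 (𝐃 (𝐃 Ψ)) x v' d) := by
      have : 𝐃 (𝐃 (𝐃 Ψ)) x v v = 𝐃 (𝐃 (𝐃 Ψ)) x v' v' + 𝐃 (𝐃 (𝐃 Ψ)) x v' d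
          + 𝐃 (𝐃 (𝐃 Ψ)) x d v := by
        conv_lhs => rw [hvd, map_add (𝐃 (𝐃 (𝐃 Ψ)) x), add_apply, map_add (𝐃 (𝐃 (𝐃 Ψ)) x v')]
        rw [← hvd]
      rw [this] at hb
      rw [map_sub, eq_neg_of_add_eq_zero_right hb, eq_neg_of_add_eq_zero_right hb']
      abel
    refine (mul_norm_le_of_coercive hpos _).trans ?_
    rw [e1, norm_neg]
    refine (norm_add_le _ _).trans ?_
    have a1 := (𝐃 (𝐃 (𝐃 Ψ)) x).le_opNorm₂ d v
    have a2 := (𝐃 (𝐃 (𝐃 Ψ)) x).le_opNorm₂ v' d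
    have a3 : ‖𝐃 (𝐃 (𝐃 Ψ)) x‖ * (‖d‖ * S) ≤ C * (‖d‖ * S) := by gcongr
    rw [hSdef] at a3 ⊢
    linarith
  have h3' : |𝐃 (𝐃 (𝐃 Ψ)) x b u u - 𝐃 (𝐃 (𝐃 Ψ)) x b' u u| ≤ C ^ 2 / m * ‖d‖ * S * ‖u‖ ^ 2 := by
    have e1 : 𝐃 (𝐃 (𝐃 Ψ)) x b u u - 𝐃 (𝐃 (𝐃 Ψ)) x b' u u = 𝐃 (𝐃 (𝐃 Ψ)) x (b - b') u u := by
      simp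
    have e2 : ‖b - b'‖ ≤ C * ‖d‖ * S / m := by
      rw [le_div_iff₀ hm]; linarith
    have e3 : ‖𝐃 (𝐃 (𝐃 Ψ)) x (b - b')‖ ≤ C * (C * ‖d‖ * S / m) := by
      refine (ContinuousLinearMap.le_opNorm _ _).trans ?_
      gcongr
    rw [e1]
    refine (abs_apply_apply_le_of_norm_le e3 u u).trans (le_of_eq ?_)
    ring
  have hfinal : (C + C ^ 2 / m) * ‖d‖ * S * ‖u‖ ^ 2
      ≤ (C + C ^ 2 / m) * (2 + C / m) / m * |a| * ‖u‖ * ‖v‖ := by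
    have h5 : ‖d‖ * ‖u‖ ≤ |a| / m := by
      rw [le_div_iff₀ hm]; linarith
    calc (C + C ^ 2 / m) * ‖d‖ * S * ‖u‖ ^ 2
        = (C + C ^ 2 / m) * ‖u‖ * ((‖d‖ * ‖u‖) * S) := by ring
      _ ≤ (C + C ^ 2 / m) * ‖u‖ * (|a| / m * ((2 + C / m) * ‖v‖)) := by gcongr
      _ = _ := by ring
  have h4' := le_of_abs_le h4
  have h3'' := le_of_abs_le h3'
  linarith

end CurvatureBound

/-! ### The cost difference along a Legendre curve. -/

section CostDifference

variable {E : Type*} [NormedAddCommGroup E] [InnerProductSpace ℝ E] {f : E → ℝ} {s : Set E} {m : ℝ}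

theorem IsLegendreCurveAt.hasDerivAt_cost_sub {w w' : ℝ → E} {w'' : E} {η : E →L[ℝ] ℝ} {t : ℝ}
    (h : IsLegendreCurveAt f η w w' w'' t) {k : E} (hf : ContDiffAt ℝ 4 f (w t))
    (hk : ContDiffAt ℝ 4 f (w t + k)) :
    (∀ᶠ r in 𝓝 t, HasDerivAt (fun r => -f (w r + k) + f (w r))
      (-𝐃 f (w r + k) (w' r) + 𝐃 f (w r) (w' r)) r) ∧
    HasDerivAt (fun r => -𝐃 f (w r + k) (w' r) + 𝐃 f (w r) (w' r))
      ((-𝐃 (𝐃 f) (w t + k) (w' t) (w' t) - 𝐃 f (w t + k) w'')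
        - (-𝐃 (𝐃 f) (w t) (w' t) (w' t) - 𝐃 f (w t) w'')) t := by
  have hcont : ContinuousAt w t := h.hasDerivAt.self_of_nhds.continuousAt
  have hcontk : ContinuousAt (fun r => w r + k) t := hcont.add continuousAt_const
  constructor
  · filter_upwards [h.hasDerivAt, hcont.eventually (hf.eventually (by norm_num)),
      hcontk.eventually (hk.eventually (by norm_num))] with r hr h1 h2
    exact ((h2.differentiableAt (by norm_num)).hasFDerivAt.comp_hasDerivAt r
      (hr.add_const k)).neg.add ((h1.differentiableAt (by norm_num)).hasFDerivAt.comp_hasDerivAt r hr)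
  · have hr := h.hasDerivAt.self_of_nhds
    have key : ∀ {y}, ContDiffAt ℝ 4 f y → DifferentiableAt ℝ (𝐃 f) y := fun {y} hy =>
      ContDiffAt.differentiableAt (n := 3) (hy.fderiv_right (by norm_num)) (by norm_num)
    have e1 := (key hk).hasFDerivAt.comp_hasDerivAt t (hr.add_const k)
    have e2 := (key hf).hasFDerivAt.comp_hasDerivAt t hr
    refine ((e1.clm_apply h.hasDerivAt_deriv).neg.add
      (e2.clm_apply h.hasDerivAt_deriv)).congr_deriv ?_
    simp
    ring

theorem legendreCurve_zero (hf : InjOn (𝐃 f) s) {w₀ : E} (h₀ : w₀ ∈ s) (η : E →L[ℝ] ℝ) :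
    legendreCurve f s (𝐃 f w₀) η 0 = w₀ := by
  rw [legendreCurve, zero_smul, add_zero, legendreInv_fderiv hf h₀]

theorem legendreCurve_one (hf : InjOn (𝐃 f) s) {w₀ w₁ : E} (h₁ : w₁ ∈ s) :
    legendreCurve f s (𝐃 f w₀) (𝐃 f w₁ - 𝐃 f w₀) 1 = w₁ := by
  rw [legendreCurve, one_smul, add_sub_cancel, legendreInv_fderiv hf h₁]

/-- The gradient image of the ball is convex, so it contains the whole segment; injectivity on `s`
forces the global inverse to return the preimage lying in the ball. -/
theorem StrongConvexOn.legendreCurve_mem_ball [FiniteDimensional ℝ E] (hf : StrongConvexOn s m f)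
    (hm : 0 < m) (hs : IsOpen s) (hd : ContDiffOn ℝ 4 f s) {p : E} {r K : ℝ}
    (hps : Metric.ball p r ⊆ s)
    (hK : ∀ x ∈ Metric.ball p r, ‖𝐃 (𝐃 (𝐃 f)) x‖ ≤ K) (hr : 8 * K * r ≤ m) {w₀ w₁ : E}
    (h₀ : w₀ ∈ Metric.ball p r) (h₁ : w₁ ∈ Metric.ball p r) {t : ℝ} (ht : t ∈ Icc (0 : ℝ) 1) :
    legendreCurve f s (𝐃 f w₀) (𝐃 f w₁ - 𝐃 f w₀) t ∈ Metric.ball p r ∧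
    𝐃 f (legendreCurve f s (𝐃 f w₀) (𝐃 f w₁ - 𝐃 f w₀) t)
      = 𝐃 f w₀ + t • (𝐃 f w₁ - 𝐃 f w₀) := by
  obtain ⟨w, hw, hwe⟩ := hf.convex_image_fderiv_ball hm hs hd hps hK hr
    (mem_image_of_mem _ h₀) (mem_image_of_mem _ h₁) (sub_nonneg.2 ht.2) ht.1 (sub_add_cancel 1 t)
  have e : 𝐃 f w₀ + t • (𝐃 f w₁ - 𝐃 f w₀) = 𝐃 f w := by
    rw [hwe]; module
  rw [legendreCurve, e,
    legendreInv_fderiv (hf.injOn_fderiv hm hs (hd.differentiableOn (by norm_num))) (hps hw)]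
  exact ⟨hw, rfl⟩

end CostDifference

/-! ### (NOAB) implies (QQConv) on small balls. -/

section Sufficiency

variable {n : ℕ} {Ψ : EuclideanSpace ℝ (Fin n) → ℝ} {Ω : Set (EuclideanSpace ℝ (Fin n))} {m : ℝ}

/-- The second derivative of the cost difference along a `c`-segment at a point where its first
derivative is `-(𝐃 Ψ y - 𝐃 Ψ w) u`. -/
theorem second_variation_ge (hΩ : IsOpen Ω) (hΨ : ContDiffOn ℝ 4 Ψ Ω) (hm : 0 < m)
    (hconv : StrongConvexOn Ω m Ψ) (hN : NOAB Ω Ψ) {p : EuclideanSpace ℝ (Fin n)} {r C R : ℝ}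
    (hps : Metric.ball p r ⊆ Ω)
    (hC : ∀ x ∈ Metric.ball p r,
      ‖𝐃 (𝐃 Ψ) x‖ ≤ C ∧ ‖𝐃 (𝐃 (𝐃 Ψ)) x‖ ≤ C ∧ ‖𝐃 (𝐃 (𝐃 (𝐃 Ψ))) x‖ ≤ C)
    (hr : 8 * C * r ≤ m) {w y u a : EuclideanSpace ℝ (Fin n)} (hw : w ∈ Metric.ball p r)
    (hy : y ∈ Metric.ball p r) (hua : 𝐃 (𝐃 (𝐃 Ψ)) w u u + 𝐃 (𝐃 Ψ) w a = 0)
    (hu : ‖u‖ ≤ R) (hwy : ‖𝐃 Ψ y - 𝐃 Ψ w‖ ≤ m * R) :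
    -((C + C ^ 2 / m) * (2 + C / m) / m * R ^ 2 * |(𝐃 Ψ y - 𝐃 Ψ w) u|)
      ≤ (-𝐃 (𝐃 Ψ) y u u - 𝐃 Ψ y a) - (-𝐃 (𝐃 Ψ) w u u - 𝐃 Ψ w a) := by
  have hdo : DifferentiableOn ℝ Ψ Ω := hΨ.differentiableOn (by norm_num)
  have hinj := hconv.injOn_fderiv hm hΩ hdo
  have hC0 : 0 ≤ C := (norm_nonneg _).trans (hC w hw).1
  have hR0 : 0 ≤ R := (norm_nonneg _).trans hu
  have hat : ∀ x ∈ Ω, ContDiffAt ℝ 4 Ψ x := fun x hx => hΨ.contDiffAt (hΩ.mem_nhds hx)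
  have hat1 : ∀ x ∈ Ω, ContDiffAt ℝ 3 (𝐃 Ψ) x := fun x hx =>
    (hat x hx).fderiv_right (by norm_num)
  have hpos : ∀ x ∈ Ω, ∀ v, m * ‖v‖ ^ 2 ≤ 𝐃 (𝐃 Ψ) x v v := fun x hx =>
    hconv.fderiv_fderiv_ge hΩ hdo hx ((hat1 x hx).differentiableAt (by norm_num))
  set ξ := 𝐃 Ψ y - 𝐃 Ψ w with hξ
  set z := legendreCurve Ψ Ω (𝐃 Ψ w) ξ with hz
  have hz0 : z 0 = w := legendreCurve_zero hinj (hps hw) _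
  have hz1 : z 1 = y := legendreCurve_one hinj (hps hy)
  have hzmem : ∀ t ∈ Icc (0 : ℝ) 1, z t ∈ Metric.ball p r := fun t ht =>
    (hconv.legendreCurve_mem_ball hm hΩ hΨ hps (fun x hx => (hC x hx).2.1) hr hw hy ht).1
  have hleg : ∀ t ∈ Icc (0 : ℝ) 1, IsLegendreCurveAt Ψ ξ z (deriv z) (deriv (deriv z) t) t := by
    intro t ht
    refine (hconv.isLegendreCurveAt hm hΩ hΨ ?_).2
    rw [← (hconv.legendreCurve_mem_ball hm hΩ hΨ hps (fun x hx => (hC x hx).2.1) hr hw hy ht).2]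
    exact mem_image_of_mem _ (hps (hzmem t ht))
  have hvar := fun t ht => (hleg t ht).hasDerivAt_second_variation (hat _ (hps (hzmem t ht))) u a
  have hmain := sub_ge_of_deriv2_ge
    (c := (C + C ^ 2 / m) * (2 + C / m) / m * R ^ 2 * |ξ u|)
    (g := fun r => -𝐃 (𝐃 Ψ) (z r) u u - 𝐃 Ψ (z r) a) (by positivity)
    (fun t ht => (hvar t ht).1.self_of_nhds) (fun t ht => (hvar t ht).2) (by
      -- The initial slope is `-(Ψ_{uu·} + Ψ_{a·})` at `w` applied to `z' 0`, which `hua`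
      -- annihilates.
      have h1 := DFunLike.congr_fun hua (deriv z 0)
      simp only [add_apply, zero_apply] at h1
      simp only [hz0]
      rw [ContDiffAt.fderiv2_comm ((hat1 w (hps hw)).of_le (by norm_num)) _ u,
        ContDiffAt.fderiv3_comm_right ((hat w (hps hw)).of_le (by norm_num)) u _ u,
        ContDiffAt.fderiv2_comm ((hat w (hps hw)).of_le (by norm_num)) _ a]
      linarith) (fun t ht => by
      have hzt := hzmem t ht
      have hzΩ := hps hzt
      obtain ⟨c2, c3, c4⟩ := hC _ hzt
      rw [← antiBisectional_eq hm (hat _ hzΩ) (hpos _ hzΩ) (hleg t ht).fderiv3_add]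
      refine le_trans ?_ (antiBisectional_ge hm (hat _ hzΩ) (hpos _ hzΩ) c2 c3 c4 (hN _ hzΩ) _ _)
      -- The defect from orthogonality is constant along `z`, so the curvature bound integrates to a
      -- multiple of `|ξ u|`.
      have e1 : 𝐃 (𝐃 Ψ) (z t) u (deriv z t) = ξ u := by
        rw [ContDiffAt.fderiv2_comm ((hat _ hzΩ).of_le (by norm_num)), (hleg t ht).fderiv2_apply]
      have e2 : ‖deriv z t‖ ≤ R := by
        have := mul_norm_le_of_coercive (hpos _ hzΩ) (deriv z t)
        rw [(hleg t ht).fderiv2_apply] at this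
        exact le_of_mul_le_mul_left (this.trans hwy) hm
      rw [e1, neg_le_neg_iff]
      calc (C + C ^ 2 / m) * (2 + C / m) / m * |ξ u| * ‖u‖ * ‖deriv z t‖
          ≤ (C + C ^ 2 / m) * (2 + C / m) / m * |ξ u| * R * R := by gcongr
        _ = _ := by ring)
  simpa only [hz0, hz1] using hmain

/-- The one-sided form of quantitative quasiconvexity, in terms of differences `w = x - y`. -/
theorem exists_legendreCurve_quasiconvex (hΩ : IsOpen Ω) (hΨ : ContDiffOn ℝ 4 Ψ Ω) (hm : 0 < m)
    (hconv : StrongConvexOn Ω m Ψ) (hN : NOAB Ω Ψ) {z p k : EuclideanSpace ℝ (Fin n)} {ε C : ℝ}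
    (hps : Metric.ball z (2 * ε) ⊆ Ω)
    (hC : ∀ x ∈ Metric.ball z (2 * ε),
      ‖𝐃 (𝐃 Ψ) x‖ ≤ C ∧ ‖𝐃 (𝐃 (𝐃 Ψ)) x‖ ≤ C ∧ ‖𝐃 (𝐃 (𝐃 (𝐃 Ψ))) x‖ ≤ C)
    (hr : 8 * C * ε ≤ m) (hpk : p + k = z) (hk : ‖k‖ < ε)
    {w₀ w₁ : EuclideanSpace ℝ (Fin n)} (hw₀ : w₀ ∈ Metric.ball p ε) (hw₁ : w₁ ∈ Metric.ball p ε) :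
    ∃ w : ℝ → EuclideanSpace ℝ (Fin n), w 0 = w₀ ∧ w 1 = w₁ ∧
      (∀ t ∈ Icc (0 : ℝ) 1, w t ∈ Metric.ball p ε ∧
        𝐃 Ψ (w t) = 𝐃 Ψ w₀ + t • (𝐃 Ψ w₁ - 𝐃 Ψ w₀)) ∧
      ∀ h, ‖h - k‖ < ε → ∀ t ∈ Icc (0 : ℝ) 1,
        -Ψ (w t + h) + Ψ (w t) - (-Ψ (w₀ + h) + Ψ w₀)
          ≤ Real.exp ((C + C ^ 2 / m) * (2 + C / m) / m * (4 * C * ε / m) ^ 2 + 1) * t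
            * max (-Ψ (w₁ + h) + Ψ w₁ - (-Ψ (w₀ + h) + Ψ w₀)) 0 := by
  have hdo : DifferentiableOn ℝ Ψ Ω := hΨ.differentiableOn (by norm_num)
  have hinj := hconv.injOn_fderiv hm hΩ hdo
  have hε : 0 < ε := Metric.pos_of_mem_ball hw₀
  have hat : ∀ x ∈ Ω, ContDiffAt ℝ 4 Ψ x := fun x hx => hΨ.contDiffAt (hΩ.mem_nhds hx)
  have hat1 : ∀ x ∈ Ω, ContDiffAt ℝ 3 (𝐃 Ψ) x := fun x hx =>
    (hat x hx).fderiv_right (by norm_num)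
  have hpos : ∀ x ∈ Ω, ∀ v, m * ‖v‖ ^ 2 ≤ 𝐃 (𝐃 Ψ) x v v := fun x hx =>
    hconv.fderiv_fderiv_ge hΩ hdo hx ((hat1 x hx).differentiableAt (by norm_num))
  have hsub : ∀ q, ‖q - z‖ < ε → Metric.ball q ε ⊆ Metric.ball z (2 * ε) := fun q hq =>
    Metric.ball_subset_ball' (by rw [dist_eq_norm]; linarith)
  have hpz : p - z = -k := by rw [← hpk]; abel
  have hpsub := hsub p (by rwa [hpz, norm_neg])
  have hC0 : 0 ≤ C := (norm_nonneg _).trans (hC w₀ (hpsub hw₀)).1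
  have hlip : ∀ x ∈ Metric.ball z (2 * ε), ∀ y ∈ Metric.ball z (2 * ε),
      ‖𝐃 Ψ y - 𝐃 Ψ x‖ ≤ m * (4 * C * ε / m) := by
    intro x hx y hy
    have h1 := Convex.norm_image_sub_le_of_norm_fderiv_le (f := 𝐃 Ψ) (C := C)
      (fun x hx => (hat1 x (hps hx)).differentiableAt (by norm_num)) (fun x hx => (hC x hx).1)
      (convex_ball z (2 * ε)) hx hy
    have h2 : ‖y - x‖ ≤ 4 * ε := by
      rw [← dist_eq_norm]
      have := dist_triangle_right y x z
      rw [Metric.mem_ball] at hx hy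
      linarith
    rw [mul_div_cancel₀ _ hm.ne']
    nlinarith
  set η := 𝐃 Ψ w₁ - 𝐃 Ψ w₀ with hη
  set w := legendreCurve Ψ Ω (𝐃 Ψ w₀) η with hw
  have hmem := fun t (ht : t ∈ Icc (0 : ℝ) 1) => hconv.legendreCurve_mem_ball hm hΩ hΨ
    (hpsub.trans hps) (fun x hx => (hC x (hpsub hx)).2.1) hr hw₀ hw₁ ht
  have hwz : w 0 = w₀ := legendreCurve_zero hinj (hps (hpsub hw₀)) _
  have hwo : w 1 = w₁ := legendreCurve_one hinj (hps (hpsub hw₁))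
  refine ⟨w, hwz, hwo, hmem, ?_⟩
  intro h hh t ht
  -- A moving ball of radius `ε` holds both ends of the second curve, so image convexity is needed
  -- at radius `ε` only.
  have hwh : ∀ t ∈ Icc (0 : ℝ) 1, w t ∈ Metric.ball (w t + k) ε ∧ w t + h ∈ Metric.ball (w t + k) ε
      ∧ Metric.ball (w t + k) ε ⊆ Metric.ball z (2 * ε) := by
    intro t ht
    refine ⟨?_, ?_, hsub _ ?_⟩
    · rw [Metric.mem_ball, dist_eq_norm]
      simpa using hk
    · rw [Metric.mem_ball, dist_eq_norm]
      simpa using hh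
    · have h1 := (hmem t ht).1
      rw [Metric.mem_ball, dist_eq_norm] at h1
      rw [← hpk, add_sub_add_right_eq_sub]
      exact h1
  have hleg : ∀ t ∈ Icc (0 : ℝ) 1, IsLegendreCurveAt Ψ η w (deriv w) (deriv (deriv w) t) t := by
    intro t ht
    refine (hconv.isLegendreCurveAt hm hΩ hΨ ?_).2
    rw [← (hmem t ht).2]
    exact mem_image_of_mem _ (hps (hpsub (hmem t ht).1))
  have hder := fun t ht => (hleg t ht).hasDerivAt_cost_sub (k := h)
    (hat _ (hps ((hwh t ht).2.2 (hwh t ht).1))) (hat _ (hps ((hwh t ht).2.2 (hwh t ht).2.1)))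
  have hmain := sub_le_exp_mul_max_of_deriv2_ge
    (C := (C + C ^ 2 / m) * (2 + C / m) / m * (4 * C * ε / m) ^ 2)
    (f := fun r => -Ψ (w r + h) + Ψ (w r)) (by positivity)
    (fun t ht => (hder t ht).1.self_of_nhds) (fun t ht => (hder t ht).2) (fun t ht => by
      obtain ⟨a1, a2, a3⟩ := hwh t ht
      have hu : ‖deriv w t‖ ≤ 4 * C * ε / m := by
        have h1 := mul_norm_le_of_coercive (hpos _ (hps (a3 a1))) (deriv w t)
        rw [(hleg t ht).fderiv2_apply] at h1
        exact le_of_mul_le_mul_left (h1.trans (hlip _ (hpsub hw₀) _ (hpsub hw₁))) hm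
      have := second_variation_ge hΩ hΨ hm hconv hN (a3.trans hps) (fun x hx => hC x (a3 hx)) hr a1 a2
        (hleg t ht).fderiv3_add hu (hlip _ (a3 a1) _ (a3 a2))
      -- The defect is, up to sign, the first derivative of the cost difference; this closes the
      -- differential inequality.
      have e : |(𝐃 Ψ (w t + h) - 𝐃 Ψ (w t)) (deriv w t)|
          = |-𝐃 Ψ (w t + h) (deriv w t) + 𝐃 Ψ (w t) (deriv w t)| := by
        rw [← abs_neg, sub_apply]
        congr 1
        ring
      rwa [e] at this) ht
  simpa only [hwz, hwo] using hmain

theorem fderiv_comp_const_sub_left {E : Type*} [NormedAddCommGroup E] [NormedSpace ℝ E] (f : E → ℝ)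
    (x y : E) : 𝐃 (fun y => f (x - y)) y = -𝐃 f (x - y) := by
  have h1 : (fun y => f (x - y)) = (fun z => f (x + z)) ∘ ContinuousLinearEquiv.neg ℝ (M := E) := by
    ext; simp [sub_eq_add_neg]
  rw [h1, ContinuousLinearEquiv.comp_right_fderiv, fderiv_comp_add_left]
  ext v
  simp [sub_eq_add_neg]

/-- The derivative bounds are needed on `U` only, since all curves stay in `X - Y`. Taking `U = Ω`
or `U` compact serves the two parts of the theorem. -/
theorem QQConvOnSmallBalls.of_noab (hΩ : IsOpen Ω) (hΨ : ContDiffOn ℝ 4 Ψ Ω) (hm : 0 < m)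
    (hconv : StrongConvexOn Ω m Ψ) (hN : NOAB Ω Ψ) {U : Set (EuclideanSpace ℝ (Fin n))}
    (hU : U ⊆ Ω) {C : ℝ} (hC0 : 0 ≤ C)
    (hC : ∀ x ∈ U, ‖𝐃 (𝐃 Ψ) x‖ ≤ C ∧ ‖𝐃 (𝐃 (𝐃 Ψ)) x‖ ≤ C ∧ ‖𝐃 (𝐃 (𝐃 (𝐃 Ψ))) x‖ ≤ C) :
    QQConvOnSmallBalls U Ψ := by
  refine ⟨m / (8 * (C + 1)), by positivity, fun ε hε hεm c₁ c₂ hcU => ?_⟩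
  have hr : 8 * C * ε ≤ m := by
    rw [le_div_iff₀ (by positivity)] at hεm
    nlinarith
  -- A displacement of length less than `2 * ε` is split equally between the two balls.
  have hball : Metric.ball (c₁ - c₂) (2 * ε) ⊆ U := by
    intro y hy
    rw [Metric.mem_ball, dist_eq_norm] at hy
    have hn : ‖(1 / 2 : ℝ) • (y - (c₁ - c₂))‖ < ε := by
      rw [norm_smul]; norm_num; linarith
    have := hcU (c₁ + (1 / 2 : ℝ) • (y - (c₁ - c₂))) (by simpa [dist_eq_norm] using hn)
      (c₂ - (1 / 2 : ℝ) • (y - (c₁ - c₂))) (by simpa [dist_eq_norm] using hn)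
    convert this using 1
    module
  have hps := hball.trans hU
  refine ⟨_, Real.one_le_exp (x := (C + C ^ 2 / m) * (2 + C / m) / m * (4 * C * ε / m) ^ 2 + 1)
    (by positivity), ?_, ?_⟩
  · intro x₀ hx₀ y₀ hy₀ y₁ hy₁
    rw [Metric.mem_ball, dist_eq_norm] at hx₀
    have hmem : ∀ y, x₀ - y ∈ Metric.ball (x₀ - c₂) ε ↔ y ∈ Metric.ball c₂ ε := fun y => by
      rw [Metric.mem_ball, Metric.mem_ball, dist_sub_left]
    obtain ⟨w, hw0, hw1, hw, hq⟩ := exists_legendreCurve_quasiconvex hΩ hΨ hm hconv hN hps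
      (fun x hx => hC x (hball hx)) hr (p := x₀ - c₂) (k := c₁ - x₀) (by abel)
      (by rwa [norm_sub_rev]) ((hmem y₀).2 hy₀) ((hmem y₁).2 hy₁)
    refine ⟨fun t => x₀ - w t, ⟨by simp [hw0], by simp [hw1], fun t ht => ⟨?_, ?_⟩⟩, ?_⟩
    · rw [← hmem, sub_sub_cancel]
      exact (hw t ht).1
    · simp only [psiCost, fderiv_comp_sub, sub_sub_cancel]
      rw [(hw t ht).2]
      module
    · intro x hx t ht
      rw [Metric.mem_ball, dist_eq_norm] at hx
      have e : ∀ v, x - (x₀ - v) = v + (x - x₀) := fun v => by abel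
      have e' : ∀ y, x - y = x₀ - y + (x - x₀) := fun y => by abel
      have := hq (x - x₀) (by rwa [sub_sub_sub_cancel_right]) t ht
      simp only [psiCost, e, sub_sub_cancel]
      rw [e' y₀, e' y₁]
      convert this using 1
      · ring
      · congr 2
        ring
  · intro y₀ hy₀ x₀ hx₀ x₁ hx₁
    rw [Metric.mem_ball, dist_eq_norm] at hy₀
    have hmem : ∀ x, x - y₀ ∈ Metric.ball (c₁ - y₀) ε ↔ x ∈ Metric.ball c₁ ε := fun x => by
      simp [Metric.mem_ball]
    obtain ⟨w, hw0, hw1, hw, hq⟩ := exists_legendreCurve_quasiconvex hΩ hΨ hm hconv hN hps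
      (fun x hx => hC x (hball hx)) hr (p := c₁ - y₀) (k := y₀ - c₂) (by abel)
      hy₀ ((hmem x₀).2 hx₀) ((hmem x₁).2 hx₁)
    refine ⟨fun t => w t + y₀, ⟨by simp [hw0], by simp [hw1], fun t ht => ⟨?_, ?_⟩⟩, ?_⟩
    · rw [← hmem, add_sub_cancel_right]
      exact (hw t ht).1
    · simp only [psiCost, fderiv_comp_const_sub_left, add_sub_cancel_right]
      rw [(hw t ht).2]
      module
    · intro y hy t ht
      rw [Metric.mem_ball, dist_eq_norm] at hy
      have e : ∀ v, v + y₀ - y = v + (y₀ - y) := fun v => by abel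
      have e' : ∀ x, x - y = x - y₀ + (y₀ - y) := fun x => by abel
      have := hq (y₀ - y) (by rwa [sub_sub_sub_cancel_left, norm_sub_rev]) t ht
      simp only [psiCost, e, add_sub_cancel_right]
      rw [e' x₀, e' x₁]
      convert this using 1
      · ring
      · congr 2
        ring

end Sufficiency

/-! ### (QQConv) on small balls implies (NOAB). -/

section Necessity

variable {n : ℕ} {Ψ : EuclideanSpace ℝ (Fin n) → ℝ} {Ω : Set (EuclideanSpace ℝ (Fin n))} {m : ℝ}

/-- Negative curvature on an orthogonal pair creates a cost difference with a strict interior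
maximum. One pair of balls, centred at `x` and `0`, and the `c*`-half of (QQConv) suffice. -/
theorem QQConvOnSmallBalls.antiBisectional_nonneg (hΩ : IsOpen Ω) (hΨ : ContDiffOn ℝ 4 Ψ Ω)
    (hm : 0 < m) (hconv : StrongConvexOn Ω m Ψ) {U : Set (EuclideanSpace ℝ (Fin n))}
    (hU : U ⊆ Ω) (hQ : QQConvOnSmallBalls U Ψ) {x : EuclideanSpace ℝ (Fin n)} (hxU : U ∈ 𝓝 x)
    {u v : EuclideanSpace ℝ (Fin n)} (huv : iteratedFDeriv ℝ 2 Ψ x ![u, v] = 0) :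
    0 ≤ antiBisectional Ψ x u v := by
  by_contra! hneg
  obtain ⟨ε₀, hε₀, hQ⟩ := hQ
  obtain ⟨r, hr, hrU⟩ := Metric.mem_nhds_iff.1 hxU
  set ε := min ε₀ (r / 2) with hεdef
  have hε : 0 < ε := lt_min hε₀ (by positivity)
  have hsubU : ∀ a ∈ Metric.ball x ε, ∀ b ∈ Metric.ball (0 : EuclideanSpace ℝ (Fin n)) ε,
      a - b ∈ U := by
    intro a ha b hb
    refine hrU ?_
    have h1 : ε ≤ r / 2 := min_le_right _ _
    rw [Metric.mem_ball, dist_eq_norm] at ha hb ⊢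
    rw [sub_zero] at hb
    have : a - b - x = (a - x) - b := by abel
    rw [this]
    refine (norm_sub_le _ _).trans_lt ?_
    linarith
  obtain ⟨M, -, hM, -⟩ := hQ ε hε (min_le_left _ _) x 0 hsubU
  rw [iteratedFDeriv_two_eq] at huv
  have hx : x ∈ Ω := hU (mem_of_mem_nhds hxU)
  have hdo : DifferentiableOn ℝ Ψ Ω := hΨ.differentiableOn (by norm_num)
  have hinj := hconv.injOn_fderiv hm hΩ hdo
  have hat : ∀ x ∈ Ω, ContDiffAt ℝ 4 Ψ x := fun x hx => hΨ.contDiffAt (hΩ.mem_nhds hx)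
  have hat1 : ContDiffAt ℝ 3 (𝐃 Ψ) x := (hat x hx).fderiv_right (by norm_num)
  have hpos : ∀ v, m * ‖v‖ ^ 2 ≤ 𝐃 (𝐃 Ψ) x v v :=
    hconv.fderiv_fderiv_ge hΩ hdo hx (hat1.differentiableAt (by norm_num))
  have hcurve : ∀ d : EuclideanSpace ℝ (Fin n), ∃ (w w' : ℝ → EuclideanSpace ℝ (Fin n))
      (w'' : EuclideanSpace ℝ (Fin n)), w 0 = x ∧ w' 0 = d ∧
      IsLegendreCurveAt Ψ (𝐃 (𝐃 Ψ) x d) w w' w'' 0 ∧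
      ∀ᶠ t in 𝓝 (0 : ℝ), w t ∈ Metric.ball x ε ∧ 𝐃 Ψ (w t) = 𝐃 Ψ x + t • 𝐃 (𝐃 Ψ) x d := by
    intro d
    have h0 := legendreCurve_zero hinj hx (𝐃 (𝐃 Ψ) x d)
    obtain ⟨h1, h2⟩ := hconv.isLegendreCurveAt hm hΩ hΨ (q := 𝐃 Ψ x) (η := 𝐃 (𝐃 Ψ) x d) (t := 0)
      (by rw [zero_smul, add_zero]; exact mem_image_of_mem _ hx)
    refine ⟨_, _, _, h0, ?_, h2, ?_⟩
    -- The velocity at `0` is `d`, because the Hessian is injective.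
    · have h3 := h2.fderiv2_apply
      rw [h0] at h3
      have h4 := mul_norm_le_of_coercive hpos
        (deriv (legendreCurve Ψ Ω (𝐃 Ψ x) (𝐃 (𝐃 Ψ) x d)) 0 - d)
      rw [map_sub, h3, sub_self, norm_zero] at h4
      have h5 : ‖deriv (legendreCurve Ψ Ω (𝐃 Ψ x) (𝐃 (𝐃 Ψ) x d)) 0 - d‖ ≤ 0 := by
        by_contra! hc
        nlinarith
      exact sub_eq_zero.1 (norm_le_zero_iff.1 h5)
    · filter_upwards [h1, h2.hasDerivAt.self_of_nhds.continuousAt.eventually_mem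
        (Metric.ball_mem_nhds _ hε)] with t ht ht'
      rw [h0] at ht'
      exact ⟨ht', fderiv_legendreInv ht⟩
  obtain ⟨w, w', w'', hw0, hw'0, hw, hwev⟩ := hcurve u
  obtain ⟨z, z', z'', hz0, hz'0, hz, hzev⟩ := hcurve v
  have hvar := hz.hasDerivAt_second_variation (by rw [hz0]; exact hat x hx) u w''
  have hz3 := hz.fderiv3_add
  rw [hz0, hz'0] at hz3
  have hw3 := hw.fderiv3_add
  rw [hw0, hw'0] at hw3
  have hglt := eventually_lt_of_deriv2_neg hvar.1 hvar.2 (by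
      have h1 := DFunLike.congr_fun hw3 v
      simp only [add_apply, zero_apply] at h1
      simp only [hz0, hz'0]
      rw [ContDiffAt.fderiv2_comm (hat1.of_le (by norm_num)) v u,
        ContDiffAt.fderiv3_comm_right ((hat x hx).of_le (by norm_num)) u v u,
        ContDiffAt.fderiv2_comm ((hat x hx).of_le (by norm_num)) v w'']
      linarith) (by
      rw [hz0, hz'0, ← antiBisectional_eq hm (hat x hx) hpos hz3]
      exact hneg)
  obtain ⟨e, he, hev⟩ := Metric.eventually_nhds_iff.1 (hglt.and hzev)
  obtain ⟨hσ, hzσ, hLσ⟩ := hev (y := e / 2) (by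
    rw [dist_zero_right, Real.norm_eq_abs, abs_of_pos (by positivity)]; linarith)
  replace hσ := hσ (by positivity)
  set h := z (e / 2) - x with hh
  have hzh : z (e / 2) = x + h := by rw [hh]; abel
  rw [hzh] at hσ hzσ hLσ
  rw [hz0] at hσ
  have hball : Metric.ball x ε ⊆ Ω := fun a ha => hU (by
    simpa using hsubU a ha 0 (Metric.mem_ball_self hε))
  have hFd := hw.hasDerivAt_cost_sub (k := h) (by rw [hw0]; exact hat x hx)
    (by rw [hw0]; exact hat _ (hball hzσ))
  -- The slope at `0` is `-(e / 2) * Ψ_{uv} = 0`, where orthogonality is used. The second derivative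
  -- is the drop of `-Ψ_{uu} - Ψ_{w''}` from `x` to `x + h`, negative by `hσ`.
  have hFlt := eventually_lt_of_deriv2_neg hFd.1 hFd.2 (by
      simp only [hw0, hw'0]
      rw [hLσ, add_apply, smul_apply,
        ContDiffAt.fderiv2_comm ((hat x hx).of_le (by norm_num)) v u, huv]
      simp) (by
      rw [hw0, hw'0]
      linarith)
  obtain ⟨e', he', hev'⟩ := Metric.eventually_nhds_iff.1 (hFlt.and hwev)
  have hgood : ∀ δ, δ = e' / 2 ∨ δ = -(e' / 2) → -Ψ (w δ + h) + Ψ (w δ) < -Ψ (x + h) + Ψ x ∧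
      x - w δ ∈ Metric.ball (0 : EuclideanSpace ℝ (Fin n)) ε ∧
      𝐃 Ψ (w δ) = 𝐃 Ψ x + δ • 𝐃 (𝐃 Ψ) x u := by
    intro δ hδ
    have hδa : |δ| = e' / 2 := by
      rcases hδ with rfl | rfl
      · exact abs_of_pos (by positivity)
      · rw [abs_neg]; exact abs_of_pos (by positivity)
    obtain ⟨h1, h2, h3⟩ := hev' (y := δ) (by
      rw [dist_zero_right, Real.norm_eq_abs, hδa]; linarith)
    have h4 := h1 (fun h0 => by rw [h0, abs_zero] at hδa; linarith)
    rw [hw0] at h4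
    refine ⟨h4, ?_, h3⟩
    rw [mem_ball_zero_iff, norm_sub_rev, ← dist_eq_norm]
    exact h2
  have hcontra : ∀ δ, (δ = e' / 2 ∨ δ = -(e' / 2)) →
      -Ψ (w (-δ) + h) + Ψ (w (-δ)) ≤ -Ψ (w δ + h) + Ψ (w δ) → False := by
    intro δ hδ hle
    have hδ' : -δ = e' / 2 ∨ -δ = -(e' / 2) := by
      rcases hδ with rfl | rfl
      · exact Or.inr rfl
      · exact Or.inl (neg_neg _)
    obtain ⟨g1, g2, g3⟩ := hgood δ hδ
    obtain ⟨-, k2, k3⟩ := hgood (-δ) hδ'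
    obtain ⟨γ, ⟨-, -, hγ⟩, hγq⟩ := hM x (Metric.mem_ball_self hε) _ g2 _ k2
    obtain ⟨hγm, hγd⟩ := hγ (1 / 2) (by constructor <;> norm_num)
    simp only [psiCost, fderiv_comp_sub, sub_sub_cancel] at hγd
    rw [g3, k3] at hγd
    -- Injectivity of the gradient pins down the midpoint of whichever segment (QQConv) provides:
    -- the gradients at `±δ` average to `𝐃 Ψ x`.
    have hγx : x - γ (1 / 2) = x := by
      refine hinj (hU (hsubU x (Metric.mem_ball_self hε) _ hγm)) hx ?_
      rw [hγd]
      module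
    have hγ0 : γ (1 / 2) = 0 := by simpa using hγx
    have hq := hγq (x + h) hzσ (1 / 2) (by constructor <;> norm_num)
    have e1 : ∀ δ, x + h - (x - w δ) = w δ + h := fun δ => by abel
    simp only [psiCost, hγ0, sub_zero, e1, sub_sub_cancel] at hq
    rw [max_eq_right (by linarith), mul_zero] at hq
    linarith
  -- Starting from the end with the larger value makes the positive part vanish.
  rcases le_total (-Ψ (w (-(e' / 2)) + h) + Ψ (w (-(e' / 2))))
    (-Ψ (w (e' / 2) + h) + Ψ (w (e' / 2))) with hle | hle
  · exact hcontra _ (Or.inl rfl) hle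
  · exact hcontra _ (Or.inr rfl) (by rwa [neg_neg])

end Necessity

/-! ### The two equivalences. -/

theorem theorem6p6 {n : ℕ} (Ω : Set (EuclideanSpace ℝ (Fin n)))
    (hΩ_open : IsOpen Ω) (hΩ_convex : Convex ℝ Ω)
    (Ψ : EuclideanSpace ℝ (Fin n) → ℝ) (hΨ : ContDiffOn ℝ 4 Ψ Ω)
    (hΨ_convex : ∃ m : ℝ, 0 < m ∧ StrongConvexOn Ω m Ψ) :
    ((∃ C : ℝ, ∀ k : ℕ, 2 ≤ k → k ≤ 4 → ∀ x ∈ Ω, ‖iteratedFDeriv ℝ k Ψ x‖ ≤ C) →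
      (NOAB Ω Ψ ↔ QQConvOnSmallBalls Ω Ψ)) ∧
    (NOAB Ω Ψ ↔ ∀ K : Set (EuclideanSpace ℝ (Fin n)), IsCompact K → K ⊆ Ω →
      QQConvOnSmallBalls K Ψ) := by
  obtain ⟨m, hm, hconv⟩ := hΨ_convex
  refine ⟨?_, ?_, ?_⟩
  · rintro ⟨C, hC⟩
    refine ⟨fun hN => ?_, fun hQ x hx u v huv => ?_⟩
    · refine QQConvOnSmallBalls.of_noab hΩ_open hΨ hm hconv hN subset_rfl (le_max_right C 0)
        fun x hx => ?_
      rw [norm_fderiv2_eq, norm_fderiv3_eq, norm_fderiv4_eq]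
      refine ⟨?_, ?_, ?_⟩ <;>
      exact (hC _ (by norm_num) (by norm_num) x hx).trans (le_max_left _ _)
    · exact hQ.antiBisectional_nonneg hΩ_open hΨ hm hconv subset_rfl (hΩ_open.mem_nhds hx) huv
  · intro hN K hK hKΩ
    have hbound : ∀ k : ℕ, k ≤ 4 → ∃ C, ∀ x ∈ K, ‖iteratedFDeriv ℝ k Ψ x‖ ≤ C := by
      intro k hk
      refine hK.exists_bound_of_continuousOn fun x hx => ?_
      have hx' : ContDiffAt ℝ 4 Ψ x := hΨ.contDiffAt (hΩ_open.mem_nhds (hKΩ hx))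
      exact (hx'.iteratedFDeriv_right (i := k) (m := 0)
        (by rw [zero_add]; exact_mod_cast hk)).continuousAt.continuousWithinAt
    obtain ⟨C2, h2⟩ := hbound 2 (by norm_num)
    obtain ⟨C3, h3⟩ := hbound 3 (by norm_num)
    obtain ⟨C4, h4⟩ := hbound 4 (by norm_num)
    refine QQConvOnSmallBalls.of_noab hΩ_open hΨ hm hconv hN hKΩ
      (C := max (max C2 C3) (max C4 0)) (by simp) fun x hx => ?_
    rw [norm_fderiv2_eq, norm_fderiv3_eq, norm_fderiv4_eq]
    exact ⟨(h2 x hx).trans (by simp), (h3 x hx).trans (by simp), (h4 x hx).trans (by simp)⟩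
  · intro hQ x hx u v huv
    -- The curvature condition is local, so one compact neighbourhood of each point is enough.
    obtain ⟨r, hr, hrΩ⟩ := Metric.nhds_basis_closedBall.mem_iff.1 (hΩ_open.mem_nhds hx)
    exact (hQ _ (isCompact_closedBall x r) hrΩ).antiBisectional_nonneg hΩ_open hΨ hm hconv hrΩ
      (Metric.closedBall_mem_nhds x hr) huv
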